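/- \textbf{Setting.} Let $\mu_1,\mu_2\in\mathbb R^d$ be orthogonal with $\|\mu_1\|=\|\mu_2\|=\rho>0$, and let $\eta\in[0,1/2)$. A data point $(X,y)$, with tokens $X=(x^{(1)},x^{(2)})^\top\in\mathbb R^{2\times d}$, is generated as follows: the true label $\tilde y$ is uniform on $\{\pm1\}$; the signal token is $x^{(1)}=\mu_1$ if $\tilde y=1$ and $x^{(1)}=\mu_2$ if $\tilde y=-1$; the noise token $x^{(2)}=\xi\sim N(0,I_d-\mu_1\mu_1^\top/\rho^2-\mu_2\mu_2^\top/\rho^2)$ is independent of $\tilde y$; and, independently, $y=\tilde y$ with probability $1-\eta$ and $y=-\tilde y$ with probability $\eta$. The training set $(X_i,y_i)_{i\in[n]}$ consists of $n$ i.i.d. data points; sample $i$ is clean ($i\in\mathcal C$) if $y_i=\tilde y_i$ and noisy ($i\in\mathcal N$) if $y_i=-\tilde y_i$. Put $\alpha_i=1$ for $i\in\mathcal C$ and $\alpha_i=2$ for $i\in\mathcal N$, and let $r_i^\star=x_i^{(\alpha_i)}$ be the optimal token (the signal for clean samples, the noise for noisy samples). For $p\in\mathbb R^d$ let $s_i=s_i(p)=(s_{i,1},s_{i,2})^\top$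 be the softmax of $X_ip\in\mathbb R^2$, and let $r_i=r_i(p)=X_i^\top s_i=s_{i,1}x_i^{(1)}+s_{i,2}x_i^{(2)}$. Let $v(p)$ be the vector $v\in\mathbb R^d$ of minimal norm subject to $y_i\langle v,r_i(p)\rangle\ge1$ for all $i\in[n]$, with label margin $\Gamma(p)=1/\|v(p)\|$; let $v_{mm}$ be the vector of minimal norm subject to $y_i\langle v,r_i^\star\rangle\ge1$ for all $i\in[n]$, with label margin $\Gamma=1/\|v_{mm}\|$. \textbf{Proposition (optimal token condition).} There are universal constants $C_0>0$ and $c>0$ such that the following holds for every $C\ge C_0$. Let $\delta\in(0,1/2)$ and $R\in\mathbb R$, and suppose that $d\ge Cn^2\log(n/\delta)$, $n\ge C\log(1/\delta)$, $\rho\ge C\sqrt{d/n}$, $0\le\eta\le1/C$ and $R\ge C\sqrt{\eta n/d+1/\rho^2}\,\log(\rho n)$. Then, with probability at least $1-\delta$ over the training set, $v_{mm}$ exists and, simultaneously for all $p\in\mathbb R^d$, $v(p)$ exists and $$\Gamma(p)\;\le\;\Gamma-\frac{c}{\|v_{mm}\|^3\,n\,\rho^2}\cdot\max_{i\in[n]}\bigl(1-s_{i,\alpha_i}(p)\bigr).$$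 -/

import Mathlib

open MeasureTheory ProbabilityTheory

namespace TokenSelection

/-- The ambient space `ℝ^d` with its Euclidean norm. -/
abbrev Vec (d : ℕ) := EuclideanSpace ℝ (Fin d)

/-- A token matrix `X = (x⁽¹⁾, x⁽²⁾)ᵀ`, given by its two rows: `X 0` is the first token `x⁽¹⁾`
(the signal), `X 1` is the second token `x⁽²⁾` (the noise). -/
abbrev Tokens (d : ℕ) := Fin 2 → Vec d

/-- A data point `(X, ỹ, y)`: tokens, true label `ỹ`, observed (possibly flipped) label `y`. -/
abbrev Sample (d : ℕ) := Tokens d × ℝ × ℝ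

/-- The tokens of a data point. -/
def tokens {d : ℕ} (z : Sample d) : Tokens d := z.1

/-- The true label `ỹ` of a data point. -/
def trueLabel {d : ℕ} (z : Sample d) : ℝ := z.2.1

/-- The observed label `y` of a data point. -/
def label {d : ℕ} (z : Sample d) : ℝ := z.2.2

/-- A data point is clean if its label has not been flipped; otherwise it is noisy. -/
def IsClean {d : ℕ} (z : Sample d) : Prop := trueLabel z = label z

section Distribution

/-- The uniform distribution on `{1, -1}`. -/
noncomputable def uniformSign : Measure ℝ :=
  (2⁻¹ : ENNReal) • Measure.dirac (1 : ℝ) + (2⁻¹ : ENNReal) • Measure.dirac (-1 : ℝ)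

/-- The law of the flip factor: `1` with probability `1 - η`, `-1` with probability `η`. -/
noncomputable def flipSign (η : ℝ) : Measure ℝ :=
  ENNReal.ofReal (1 - η) • Measure.dirac (1 : ℝ) + ENNReal.ofReal η • Measure.dirac (-1 : ℝ)

/-- The covariance matrix `I_d - μ₁ μ₁ᵀ / ρ² - μ₂ μ₂ᵀ / ρ²` of the noise. -/
noncomputable def noiseCov {d : ℕ} (ρ : ℝ) (μ₁ μ₂ : Vec d) : Matrix (Fin d) (Fin d) ℝ :=
  1 - (1 / ρ ^ 2) • Matrix.vecMulVec μ₁.ofLp μ₁.ofLp - (1 / ρ ^ 2) • Matrix.vecMulVec μ₂.ofLp μ₂.ofLp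

/-- The law `N(0, I_d - μ₁ μ₁ᵀ / ρ² - μ₂ μ₂ᵀ / ρ²)` of the noise token. -/
noncomputable def noiseLaw {d : ℕ} (ρ : ℝ) (μ₁ μ₂ : Vec d) : Measure (Vec d) :=
  multivariateGaussian 0 (noiseCov ρ μ₁ μ₂)

/-- The signal vector of a sample with true label `t = ±1`: `μ₁` if `t = 1`, and `μ₂` otherwise. -/
noncomputable def signal {d : ℕ} (μ₁ μ₂ : Vec d) (t : ℝ) : Vec d :=
  if t = 1 then μ₁ else μ₂

/-- The clean distribution: the law of `(X, ỹ)`, where `ỹ` is uniform on `{1, -1}`, the first token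
is the signal `μ₁` or `μ₂` determined by `ỹ`, and the second token is independent noise. -/
noncomputable def cleanLaw {d : ℕ} (ρ : ℝ) (μ₁ μ₂ : Vec d) : Measure (Tokens d × ℝ) :=
  (uniformSign.prod (noiseLaw ρ μ₁ μ₂)).map fun w => (![signal μ₁ μ₂ w.1, w.2], w.1)

/-- The `η`-label-flipped distribution, recorded together with the true label: the law of
`(X, ỹ, y)`, where `(X, ỹ)` is clean and, independently, `y = ỹ` with probability `1 - η` and
`y = -ỹ` with probability `η`. -/
noncomputable def dataLaw {d : ℕ} (ρ η : ℝ) (μ₁ μ₂ : Vec d) : Measure (Sample d) :=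
  ((cleanLaw ρ μ₁ μ₂).prod (flipSign η)).map fun w => (w.1.1, w.1.2, w.2 * w.1.2)

/-- The law of a training set of `n` independent samples. -/
noncomputable def trainingLaw {d : ℕ} (n : ℕ) (ρ η : ℝ) (μ₁ μ₂ : Vec d) :
    Measure (Fin n → Sample d) :=
  Measure.pi fun _ => dataLaw ρ η μ₁ μ₂

end Distribution

section Attention

/-- The softmax of a vector in `ℝ²`. -/
noncomputable def softmax (a : Fin 2 → ℝ) (j : Fin 2) : ℝ := Real.exp (a j) / ∑ k, Real.exp (a k)

/-- The attention weights `s = 𝕊(X p)`. -/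
noncomputable def attn {d : ℕ} (X : Tokens d) (p : Vec d) : Fin 2 → ℝ :=
  softmax fun j => inner ℝ (X j) p

/-- The output `r = Xᵀ 𝕊(X p)` of the attention layer. -/
noncomputable def attnOutput {d : ℕ} (X : Tokens d) (p : Vec d) : Vec d := ∑ j, attn X p j • X j

/-- The index of the optimal token: the first (signal) for a clean sample, the second (noise) for a
noisy sample. -/
noncomputable def optIndex {d : ℕ} (z : Sample d) : Fin 2 :=
  open Classical in if IsClean z then 0 else 1

/-- The optimal token `r⋆` of a data point. -/
noncomputable def optToken {d : ℕ} (z : Sample d) : Vec d := tokens z (optIndex z)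

end Attention

section SVM

/-- `v` satisfies the margin constraints `y_i ⟨v, r_i⟩ ≥ 1` for all `i`. -/
def Separates {d n : ℕ} (r : Fin n → Vec d) (y : Fin n → ℝ) (v : Vec d) : Prop :=
  ∀ i, 1 ≤ y i * inner ℝ v (r i)

/-- `v` is a max-margin classifier (hard-margin SVM solution) of `(r_i, y_i)`: it has minimal norm
among the vectors that satisfy the margin constraints. -/
def IsSVM {d n : ℕ} (r : Fin n → Vec d) (y : Fin n → ℝ) (v : Vec d) : Prop :=
  Separates r y v ∧ ∀ w, Separates r y w → ‖v‖ ≤ ‖w‖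

/-- `v` is the max-margin classifier `v(p)` on the attention outputs `r_i = X_iᵀ 𝕊(X_i p)`. -/
def IsSVMAt {d n : ℕ} (S : Fin n → Sample d) (p v : Vec d) : Prop :=
  IsSVM (fun i => attnOutput (tokens (S i)) p) (fun i => label (S i)) v

/-- `v` is the max-margin classifier `v_mm` on the optimal tokens `r_i⋆`. -/
def IsSVMOpt {d n : ℕ} (S : Fin n → Sample d) (v : Vec d) : Prop :=
  IsSVM (fun i => optToken (S i)) (fun i => label (S i)) v

/-- The label margin `1 / ‖v‖` induced by a max-margin classifier `v`. -/
noncomputable def labelMargin {d : ℕ} (v : Vec d) : ℝ := 1 / ‖v‖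

/-- The deviation `max_i (1 - s_{i, α_i})` of the attention under `p` from the optimal token
selection (a maximum over a finite set, nonempty as soon as `n ≥ 1`). -/
noncomputable def deviation {d n : ℕ} (S : Fin n → Sample d) (p : Vec d) : ℝ :=
  ⨆ i : Fin n, (1 - attn (tokens (S i)) p (optIndex (S i)))

end SVM

/-- The assumptions on the dimension `d`, the sample size `n`, the signal strength `ρ`, the label
flipping rate `η` and the norm bound `R` on `p`, for the constant `C` and failure probability `δ`. -/
structure MaxMarginAssumption (C δ ρ η R : ℝ) (d n : ℕ) : Prop where
  δ_pos : 0 < δ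
  δ_lt : δ < 1 / 2
  dim_large : C * (n : ℝ) ^ 2 * Real.log (n / δ) ≤ d
  samples_large : C * Real.log (1 / δ) ≤ n
  signal_large : C * Real.sqrt (d / n) ≤ ρ
  flip_nonneg : 0 ≤ η
  flip_small : η ≤ 1 / C
  radius_large : C * Real.sqrt (η * n / d + 1 / ρ ^ 2) * Real.log (ρ * n) ≤ R

end TokenSelection

/-! Split a classifier along the signals and their orthogonal complement: v = (a/ρ²)μ₁ − (b/ρ²)μ₂ +
u. Then a and b are the signed margins on the two signal tokens, and ‖v‖² = (a² + b²)/ρ² + ‖u‖². On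
the optimal tokens, v is feasible as soon as a, b ≥ 1 and u has margin one on the noise tokens of
the noisy samples. So whenever v(p) can be altered into such a triple at a saving in squared norm,
minimality of v_mm gives a gap ‖v_mm‖² + saving ≤ ‖v(p)‖². The saving wanted is β/(nρ²), where β is
the weight that an arbitrary sample k puts on its wrong token.

With high probability the noise tokens are nearly orthogonal with squared norm of order d. Hence
fitting m of them with margin one costs ‖u‖² at least of order m/d
(`NearOrthogonal.card_le_of_margin`), and moving u along a single token ξ_k hardly disturbs the
other margins (`NearOrthogonal.exists_smaller`).

The gap (`norm_sq_gap`) comes from a case distinction. If ‖u‖² ≥ n/(24d), then v(p) is already too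
long, because v_mm only has to fit the noise of the few noisy samples. Otherwise u cannot fit the
noise of a whole clean class, which forces a, b ≥ 1. A noisy sample k must then overcome a signal
pointing the wrong way, so its noise margin is at least 1 + 2β, and the excess can be traded for
norm. For a clean sample k with signal margin m, either m ≥ 1 + β/2 and m can be lowered, or u has
margin at least 1/2 on ξ_k, which v_mm does not need, and part of ξ_k can be removed from u. The
savings are of order β/ρ² or β/d; both suffice because nρ² ≥ 1000d.

`one_div_le_of_sq_gap` turns the gap into one for label margins. Gaussian concentration, Hoeffding's
inequality and a union bound (`trainingLaw_not_typical_le`) show that the properties used are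
typical. They do not involve p, so the conclusion is uniform in p. -/

namespace TokenSelection

/-! ### Geometry of nearly orthogonal vectors. -/

section NearOrthogonal

variable {E : Type*} [NormedAddCommGroup E] [InnerProductSpace ℝ E] {n : ℕ}

/-- Vectors of squared norm of order `D` whose pairwise inner products are at most `D / (32 n)`. -/
structure NearOrthogonal (ξ : Fin n → E) (D : ℝ) : Prop where
  le_norm_sq : ∀ i, D / 4 ≤ ‖ξ i‖ ^ 2
  norm_sq_le : ∀ i, ‖ξ i‖ ^ 2 ≤ 2 * D
  abs_inner_le : ∀ i j, i ≠ j → |inner ℝ (ξ i) (ξ j)| ≤ D / (32 * n)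

variable {ξ : Fin n → E} {y : Fin n → ℝ} {D : ℝ}

lemma abs_sign_mul {s x : ℝ} (hs : s = 1 ∨ s = -1) : |s * x| = |x| := by
  rcases hs with rfl | rfl <;> simp

lemma sign_mul_self {s : ℝ} (hs : s = 1 ∨ s = -1) : s * s = 1 := by
  rcases hs with rfl | rfl <;> norm_num

/-- The signed inner product of one vector with the sum of all others is small. -/
lemma NearOrthogonal.abs_sum_erase_le (h : NearOrthogonal ξ D) (hD : 0 < D)
    (hy : ∀ i, y i = 1 ∨ y i = -1) (A : Finset (Fin n)) (i : Fin n) :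
    |∑ j ∈ A.erase i, y i * (y j * inner ℝ (ξ j) (ξ i))| ≤ D / 32 := by
  have hn : 0 < n := i.pos
  have hn' : (0 : ℝ) < n := by exact_mod_cast hn
  calc |∑ j ∈ A.erase i, y i * (y j * inner ℝ (ξ j) (ξ i))|
      ≤ ∑ j ∈ A.erase i, |y i * (y j * inner ℝ (ξ j) (ξ i))| := Finset.abs_sum_le_sum_abs _ _
    _ ≤ ∑ j ∈ A.erase i, D / (32 * n) := by
        refine Finset.sum_le_sum fun j hj => ?_
        rw [abs_sign_mul (hy i), abs_sign_mul (hy j)]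
        exact h.abs_inner_le j i (Finset.ne_of_mem_erase hj)
    _ = (A.erase i).card * (D / (32 * n)) := by rw [Finset.sum_const, nsmul_eq_mul]
    _ ≤ n * (D / (32 * n)) := by
        gcongr
        exact_mod_cast (Finset.card_le_univ _).trans_eq (Fintype.card_fin n)
    _ = D / 32 := by field_simp

lemma NearOrthogonal.inner_sum_eq (hy : ∀ i, y i = 1 ∨ y i = -1) {A : Finset (Fin n)} {i : Fin n}
    (hi : i ∈ A) :
    y i * inner ℝ (∑ j ∈ A, y j • ξ j) (ξ i) =
      ‖ξ i‖ ^ 2 + ∑ j ∈ A.erase i, y i * (y j * inner ℝ (ξ j) (ξ i)) := by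
  rw [sum_inner, Finset.mul_sum, ← Finset.add_sum_erase _ _ hi]
  simp only [real_inner_smul_left, real_inner_self_eq_norm_sq]
  rw [← mul_assoc, sign_mul_self (hy i), one_mul]

/-- The diagonal term D/4 dominates the cross terms D/32. Thus 8/D times the signed sum fits all of
`A` with margin one, which is the feasible point used throughout. -/
lemma NearOrthogonal.le_inner_sum (h : NearOrthogonal ξ D) (hD : 0 < D)
    (hy : ∀ i, y i = 1 ∨ y i = -1) {A : Finset (Fin n)} {i : Fin n} (hi : i ∈ A) :
    D / 8 ≤ y i * inner ℝ (∑ j ∈ A, y j • ξ j) (ξ i) := by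
  rw [NearOrthogonal.inner_sum_eq hy hi]
  have h1 := (abs_le.1 (h.abs_sum_erase_le hD hy A i)).1
  have h2 := h.le_norm_sq i
  linarith

lemma NearOrthogonal.norm_sum_sq_le (h : NearOrthogonal ξ D) (hD : 0 < D)
    (hy : ∀ i, y i = 1 ∨ y i = -1) (A : Finset (Fin n)) :
    ‖∑ j ∈ A, y j • ξ j‖ ^ 2 ≤ 3 * D * A.card := by
  calc ‖∑ j ∈ A, y j • ξ j‖ ^ 2
      = ∑ i ∈ A, y i * inner ℝ (∑ j ∈ A, y j • ξ j) (ξ i) := by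
        have key : ∀ u : E, inner ℝ u (∑ j ∈ A, y j • ξ j) = ∑ i ∈ A, y i * inner ℝ u (ξ i) :=
          fun u => by rw [inner_sum]; simp only [real_inner_smul_right]
        rw [← real_inner_self_eq_norm_sq, key]
    _ ≤ ∑ i ∈ A, 3 * D := by
        refine Finset.sum_le_sum fun i hi => ?_
        rw [NearOrthogonal.inner_sum_eq hy hi]
        have h1 := (abs_le.1 (h.abs_sum_erase_le hD hy A i)).2
        have h2 := h.norm_sq_le i
        linarith
    _ = 3 * D * A.card := by rw [Finset.sum_const, nsmul_eq_mul]; ring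

/-- A vector with margin one on every vector indexed by `A` has a large norm. -/
lemma NearOrthogonal.card_le_of_margin (h : NearOrthogonal ξ D) (hD : 0 < D)
    (hy : ∀ i, y i = 1 ∨ y i = -1) (A : Finset (Fin n)) {u : E}
    (hu : ∀ i ∈ A, 1 ≤ y i * inner ℝ u (ξ i)) : (A.card : ℝ) ≤ 3 * D * ‖u‖ ^ 2 := by
  -- Add up the margins, then apply Cauchy–Schwarz against the signed sum, whose norm is only of
  -- order √(D·|A|).
  have h1 : (A.card : ℝ) ≤ inner ℝ u (∑ j ∈ A, y j • ξ j) := by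
    rw [inner_sum]
    simp only [real_inner_smul_right]
    simpa using Finset.sum_le_sum hu
  have h2 := h1.trans (real_inner_le_norm _ _)
  have h3 : (A.card : ℝ) ^ 2 ≤ ‖u‖ ^ 2 * (3 * D * A.card) := by
    calc (A.card : ℝ) ^ 2 ≤ (‖u‖ * ‖∑ j ∈ A, y j • ξ j‖) ^ 2 := by gcongr
      _ = ‖u‖ ^ 2 * ‖∑ j ∈ A, y j • ξ j‖ ^ 2 := mul_pow _ _ _
      _ ≤ _ := by gcongr; exact h.norm_sum_sq_le hD hy A
  rcases (Nat.cast_nonneg (α := ℝ) A.card).eq_or_lt with h0 | h0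
  · rw [← h0]; positivity
  · refine le_of_mul_le_mul_right ?_ h0
    linarith

/-- Excess margin on one vector can be traded for a smaller norm, keeping the margins on `A`. -/
lemma NearOrthogonal.exists_smaller (h : NearOrthogonal ξ D) (hD : 0 < D)
    (hy : ∀ i, y i = 1 ∨ y i = -1) (V : Submodule ℝ E) (hV : ∀ i, ξ i ∈ V)
    (A : Finset (Fin n)) {u : E} (huV : u ∈ V) {k : Fin n} {β : ℝ} (hβ0 : 0 ≤ β) (hβ1 : β ≤ 1)
    (hu : ∀ i ∈ A, 1 ≤ y i * inner ℝ u (ξ i))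
    (hk : k ∈ A → 1 + 2 * β ≤ y k * inner ℝ u (ξ k)) (hk' : 1 / 2 ≤ y k * inner ℝ u (ξ k))
    (hnorm : ‖u‖ ^ 2 ≤ n / D) :
    ∃ u' ∈ V, (∀ i ∈ A, 1 ≤ y i * inner ℝ u' (ξ i)) ∧ ‖u'‖ ^ 2 ≤ ‖u‖ ^ 2 - β / (16 * D) := by
  have hn : (1 : ℝ) ≤ n := by exact_mod_cast k.pos
  -- Subtracting τ y_k ξ_k costs at most 2Dτ = β/2 of the margin at k, less than the excess 2β, and
  -- at most κ of any other margin. Rescaling by 1/(1 − κ) then restores margin one.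
  set τ : ℝ := β / (4 * D) with hτ
  set κ : ℝ := β / (128 * n) with hκ
  have hτ0 : 0 ≤ τ := by positivity
  have hκ0 : 0 ≤ κ := by positivity
  have hκ1 : κ ≤ 1 / 128 := by
    rw [hκ, div_le_div_iff₀ (by positivity) (by norm_num)]; nlinarith
  have hτκ : τ * (D / (32 * n)) = κ := by rw [hτ, hκ]; field_simp; ring
  have hτD : τ * (2 * D) = β / 2 := by rw [hτ]; field_simp; ring
  set w : E := u - τ • (y k • ξ k) with hw
  have hwi : ∀ i, y i * inner ℝ w (ξ i) =
      y i * inner ℝ u (ξ i) - τ * (y i * (y k * inner ℝ (ξ k) (ξ i))) := fun i => by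
    rw [hw, inner_sub_left, real_inner_smul_left, real_inner_smul_left]; ring
  have hwA : ∀ i ∈ A, 1 - κ ≤ y i * inner ℝ w (ξ i) := by
    intro i hi
    rw [hwi]
    by_cases hik : i = k
    · subst hik
      rw [← mul_assoc (y i), sign_mul_self (hy i), one_mul, real_inner_self_eq_norm_sq]
      have := mul_le_mul_of_nonneg_left (h.norm_sq_le i) hτ0
      have := hk hi
      linarith
    · have h1 := h.abs_inner_le k i (Ne.symm hik)
      rw [← abs_sign_mul (hy k), ← abs_sign_mul (hy i)] at h1
      have h2 := mul_le_mul_of_nonneg_left ((abs_le.1 h1).2) hτ0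
      have := hu i hi
      linarith
  -- Margin 1/2 at k is enough here, whether or not k lies in `A`: the linear gain is at least τ and
  -- the quadratic loss at most τ/2.
  have hwn : ‖w‖ ^ 2 ≤ ‖u‖ ^ 2 - β / (8 * D) := by
    have h1 : ‖w‖ ^ 2 = ‖u‖ ^ 2 - 2 * τ * (y k * inner ℝ u (ξ k)) + τ * (τ * ‖ξ k‖ ^ 2) := by
      rw [hw, norm_sub_sq_real, real_inner_smul_right, real_inner_smul_right, norm_smul, norm_smul]
      have : ‖y k‖ = 1 := by rcases hy k with h | h <;> simp [h]
      rw [this, mul_pow, Real.norm_eq_abs, sq_abs]; ring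
    have h2 : τ * ‖ξ k‖ ^ 2 ≤ β / 2 :=
      (mul_le_mul_of_nonneg_left (h.norm_sq_le k) hτ0).trans_eq hτD
    have h3 : τ * (τ * ‖ξ k‖ ^ 2) ≤ τ * (1 / 2) := by gcongr; linarith
    have h4 : 2 * τ * (1 / 2) ≤ 2 * τ * (y k * inner ℝ u (ξ k)) := by gcongr
    have h5 : β / (8 * D) = τ / 2 := by rw [hτ]; field_simp; ring
    linarith
  have hκpos : 0 < 1 - κ := by linarith
  refine ⟨(1 - κ)⁻¹ • w, V.smul_mem _ (V.sub_mem huV (V.smul_mem _ (V.smul_mem _ (hV k)))),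
    fun i hi => ?_, ?_⟩
  · rw [real_inner_smul_left, mul_left_comm, inv_mul_eq_div, le_div_iff₀ hκpos, one_mul]
    exact hwA i hi
  · rw [norm_smul, mul_pow, Real.norm_eq_abs, sq_abs]
    have h1 : ((1 - κ)⁻¹) ^ 2 ≤ 1 + 4 * κ := by
      rw [inv_pow, inv_le_iff_one_le_mul₀ (by positivity)]
      nlinarith [sq_nonneg κ, mul_nonneg hκ0 hκ0]
    -- The price of rescaling: the factor 1/n in κ cancels the bound n/D on ‖u‖², leaving a quarter
    -- of the gain β/(8D).
    have h2 : 4 * κ * ‖u‖ ^ 2 ≤ β / (32 * D) := by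
      calc 4 * κ * ‖u‖ ^ 2 ≤ 4 * κ * (n / D) := by gcongr
        _ = β / (32 * D) := by rw [hκ]; field_simp; ring
    have h3 : β / (8 * D) = 4 * (β / (32 * D)) := by field_simp; ring
    have h4 : β / (16 * D) = 2 * (β / (32 * D)) := by field_simp; ring
    have h5 : 0 ≤ β / (32 * D) := by positivity
    calc ((1 - κ)⁻¹) ^ 2 * ‖w‖ ^ 2 ≤ (1 + 4 * κ) * ‖w‖ ^ 2 := by gcongr
      _ ≤ (1 + 4 * κ) * (‖u‖ ^ 2 - β / (8 * D)) := by gcongr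
      _ ≤ ‖u‖ ^ 2 - β / (16 * D) := by
        rw [h3, h4]; nlinarith [mul_nonneg hκ0 h5]

end NearOrthogonal

/-! ### The gap between squared norms, by cases. -/

section MarginGap

variable {E : Type*} [NormedAddCommGroup E] [InnerProductSpace ℝ E] {n : ℕ}
  {ξ : Fin n → E} {y : Fin n → ℝ} {D : ℝ}

/-- The increase of the squared norm forced by a deviation from the optimal tokens, in terms of the
signal coefficients `a`, `b` and the noise component `u` of a classifier. The number `W` stands for
the squared norm of the max-margin classifier on the optimal tokens, `m i` for the signal margin of
the class of sample `i`, and `β i` for the attention on the other token. -/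
theorem norm_sq_gap (h : NearOrthogonal ξ D) (hD : 0 < D) (hy : ∀ i, y i = 1 ∨ y i = -1)
    (V : Submodule ℝ E) (hV : ∀ i, ξ i ∈ V) (P Q N : Finset (Fin n)) {ρ W a b : ℝ} (hρ : 0 < ρ)
    (hρn : 1000 * D ≤ n * ρ ^ 2)
    (hP : (n : ℝ) ≤ 8 * P.card) (hQ : (n : ℝ) ≤ 8 * Q.card) (hN : 10000 * (N.card : ℝ) ≤ n)
    (hW : ∀ a' b' : ℝ, ∀ u' ∈ V, 1 ≤ a' → 1 ≤ b' → (∀ i ∈ N, 1 ≤ y i * inner ℝ u' (ξ i)) →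
      W ≤ (a' ^ 2 + b' ^ 2) / ρ ^ 2 + ‖u'‖ ^ 2)
    {u : E} (hu : u ∈ V) {β : Fin n → ℝ} (hβ0 : ∀ i, 0 < β i) (hβ1 : ∀ i, β i < 1)
    (hcP : ∀ i ∈ P, 1 ≤ (1 - β i) * a + β i * (y i * inner ℝ u (ξ i)))
    (hcQ : ∀ i ∈ Q, 1 ≤ (1 - β i) * b + β i * (y i * inner ℝ u (ξ i)))
    (hcN : ∀ i ∈ N, 1 ≤ (1 - β i) * (y i * inner ℝ u (ξ i)) - β i * a ∨
      1 ≤ (1 - β i) * (y i * inner ℝ u (ξ i)) - β i * b)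
    (hcover : ∀ i, i ∈ P ∨ i ∈ Q ∨ i ∈ N) (k : Fin n) :
    W + β k / (n * ρ ^ 2) ≤ (a ^ 2 + b ^ 2) / ρ ^ 2 + ‖u‖ ^ 2 := by
  have hn : (1 : ℝ) ≤ n := by exact_mod_cast k.pos
  have hn0 : (0 : ℝ) < n := by linarith
  have hρ2 : 0 < ρ ^ 2 := by positivity
  have hinv : 1 / ρ ^ 2 ≤ n / (1000 * D) := by
    rw [div_le_div_iff₀ hρ2 (by positivity)]; linarith
  have hβn : β k / (n * ρ ^ 2) ≤ β k / (1000 * D) :=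
    div_le_div_of_nonneg_left (hβ0 k).le (by positivity) hρn
  have hab : 0 ≤ (a ^ 2 + b ^ 2) / ρ ^ 2 := by positivity
  rcases le_or_gt ((n : ℝ) / (24 * D)) (‖u‖ ^ 2) with hbig | hsmall
  · have hW0 : W ≤ 2 / ρ ^ 2 + (8 / D) ^ 2 * (3 * D * N.card) := by
      have := hW 1 1 ((8 / D) • ∑ j ∈ N, y j • ξ j)
        (V.smul_mem _ (V.sum_mem fun j _ => V.smul_mem _ (hV j))) le_rfl le_rfl (fun i hi => by
          rw [real_inner_smul_left, mul_left_comm]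
          calc (1 : ℝ) = 8 / D * (D / 8) := by field_simp
            _ ≤ _ := by gcongr; exact h.le_inner_sum hD hy hi)
      rw [norm_smul, mul_pow, Real.norm_eq_abs, sq_abs] at this
      norm_num at this ⊢
      refine this.trans ?_
      gcongr
      exact h.norm_sum_sq_le hD hy N
    have h1 : (8 / D) ^ 2 * (3 * D * N.card) ≤ 192 / 10000 * (n / D) := by
      calc (8 / D) ^ 2 * (3 * D * N.card) = 192 / 10000 * ((10000 * N.card) / D) := by
            field_simp; ring
        _ ≤ _ := by gcongr
    have h2 : β k / (1000 * D) ≤ 1 / 1000 * (n / D) := by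
      rw [div_le_iff₀ (by positivity)]
      have : 1 / 1000 * (n / D) * (1000 * D) = n := by field_simp
      rw [this]; linarith [hβ1 k]
    have h3 : n / (1000 * D) = 1 / 1000 * (n / D) := by field_simp
    have h4 : n / (24 * D) = 1 / 24 * (n / D) := by field_simp
    have h5 : 2 / ρ ^ 2 = 2 * (1 / ρ ^ 2) := by ring
    have h6 : 0 < n / D := by positivity
    linarith
  · have hmargin : ∀ A : Finset (Fin n), (n : ℝ) ≤ 8 * A.card → ∀ m : ℝ,
        (∀ i ∈ A, 1 ≤ (1 - β i) * m + β i * (y i * inner ℝ u (ξ i))) → 1 ≤ m := by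
      intro A hA m hm
      by_contra! hlt
      have h1 := h.card_le_of_margin hD hy A (u := u) fun i hi => by
        have h1 := hm i hi
        have h2 := hβ0 i
        have h3 := hβ1 i
        by_contra! hq
        nlinarith
      rw [lt_div_iff₀ (by positivity)] at hsmall
      linarith
    have ha : 1 ≤ a := hmargin P hP a hcP
    have hb : 1 ≤ b := hmargin Q hQ b hcQ
    -- The opposing signal has margin at least 1, so the noise margin is at least (1 + β)/(1 − β) ≥
    -- 1 + 2β.
    have hnoisy : ∀ i ∈ N, 1 + 2 * β i ≤ y i * inner ℝ u (ξ i) := by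
      intro i hi
      have h2 := hβ0 i
      have h3 := hβ1 i
      have h4 : 1 + β i ≤ (1 - β i) * (y i * inner ℝ u (ξ i)) := by
        rcases hcN i hi with h1 | h1 <;> nlinarith
      by_contra! hq
      nlinarith
    have hnoisy1 : ∀ i ∈ N, 1 ≤ y i * inner ℝ u (ξ i) := fun i hi => by
      linarith [hnoisy i hi, hβ0 i]
    have hperturb : 1 / 2 ≤ y k * inner ℝ u (ξ k) →
        W + β k / (n * ρ ^ 2) ≤ (a ^ 2 + b ^ 2) / ρ ^ 2 + ‖u‖ ^ 2 := by
      intro hk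
      obtain ⟨u', hu'V, hu', hu'n⟩ := h.exists_smaller hD hy V hV N hu (hβ0 k).le (hβ1 k).le
        hnoisy1 (hnoisy k) hk (hsmall.le.trans (by gcongr; linarith))
      have h1 := hW a b u' hu'V ha hb hu'
      have h2 : β k / (1000 * D) ≤ β k / (16 * D) := by
        have := hβ0 k
        gcongr; norm_num
      linarith
    have hclean : ∀ m m' : ℝ, 1 ≤ m → 1 ≤ (1 - β k) * m + β k * (y k * inner ℝ u (ξ k)) →
        (∀ t, 1 ≤ t → W ≤ (t ^ 2 + m' ^ 2) / ρ ^ 2 + ‖u‖ ^ 2) →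
        a ^ 2 + b ^ 2 = m ^ 2 + m' ^ 2 →
        W + β k / (n * ρ ^ 2) ≤ (a ^ 2 + b ^ 2) / ρ ^ 2 + ‖u‖ ^ 2 := by
      intro m m' hm hc hWm hsum
      have h2 := hβ0 k
      have h3 := hβ1 k
      -- If m ≥ 1 + β/2, lowering it by β/2 keeps it above 1 and lowers m² by at least β. If m is
      -- smaller, the constraint at k forces a noise margin of at least 1/2, and ξ_k can be removed
      -- from u.
      rcases le_or_gt (1 + β k / 2) m with hmβ | hmβ
      · have h1 := hWm (m - β k / 2) (by linarith)
        have h4 : β k / (n * ρ ^ 2) ≤ β k / ρ ^ 2 :=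
          div_le_div_of_nonneg_left h2.le hρ2 (le_mul_of_one_le_left hρ2.le hn)
        have h5 : ((m - β k / 2) ^ 2 + m' ^ 2) / ρ ^ 2 + β k / ρ ^ 2 ≤
            (m ^ 2 + m' ^ 2) / ρ ^ 2 := by
          rw [← add_div]
          refine div_le_div_of_nonneg_right ?_ hρ2.le
          nlinarith
        rw [hsum]
        linarith
      · refine hperturb ?_
        by_contra! hq
        nlinarith [mul_pos h2 h2]
    rcases hcover k with hk | hk | hk
    · exact hclean a b ha (hcP k hk) (fun t ht => hW t b u hu ht hb hnoisy1) rfl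
    · exact hclean b a hb (hcQ k hk)
        (fun t ht => by rw [add_comm (t ^ 2)]; exact hW a t u hu ha ht hnoisy1) (add_comm _ _)
    · exact hperturb (by linarith [hnoisy1 k hk])

end MarginGap

/-! ### From squared norms to label margins. -/

/-- A gap between squared norms gives a gap between the inverse norms. -/
lemma one_div_le_of_sq_gap {w z x : ℝ} (hw : 0 < w) (hz : 0 < z) (hx0 : 0 ≤ x) (hx : x ≤ w ^ 2)
    (h : w ^ 2 + x ≤ z ^ 2) : 1 / z ≤ 1 / w - 1 / 4 / w ^ 3 * x := by
  set t := x / w ^ 2 with ht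
  have ht0 : 0 ≤ t := by positivity
  have ht1 : t ≤ 1 := div_le_one_of_le₀ hx (by positivity)
  have hxt : x = t * w ^ 2 := by rw [ht]; field_simp
  have h1 : 1 / w - 1 / 4 / w ^ 3 * x = (1 - t / 4) / w := by rw [hxt]; field_simp
  rw [h1, div_le_div_iff₀ hz hw, one_mul]
  refine (pow_le_pow_iff_left₀ hw.le (mul_nonneg (by linarith) hz.le) two_ne_zero).1 ?_
  calc w ^ 2 ≤ (1 - t / 4) ^ 2 * (w ^ 2 + x) := by
        rw [hxt]
        -- The product expands to 1 + t/2 − 7t²/16 + t³/16, which is at least 1 on [0, 1].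
        have : 1 ≤ (1 - t / 4) ^ 2 * (1 + t) := by
          nlinarith [mul_nonneg ht0 ht0, mul_nonneg ht0 (sub_nonneg.2 ht1),
            mul_nonneg (mul_nonneg ht0 ht0) ht0]
        nlinarith [mul_le_mul_of_nonneg_right this (sq_nonneg w)]
    _ ≤ (1 - t / 4) ^ 2 * z ^ 2 := by gcongr
    _ = ((1 - t / 4) * z) ^ 2 := by ring

/-! ### Existence of max-margin classifiers, and attention weights. -/

section Existence

variable {d n : ℕ}

/-- The feasible set is closed and nonempty in a finite-dimensional space, so it has a point nearest
to the origin. -/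
lemma exists_isSVM {r : Fin n → Vec d} {y : Fin n → ℝ} {w : Vec d} (hw : Separates r y w) :
    ∃ v, IsSVM r y v := by
  have hcl : IsClosed {v | Separates r y v} := by
    simp only [Separates, Set.ofPred_forall]
    exact isClosed_iInter fun i => isClosed_le continuous_const (by fun_prop)
  obtain ⟨v, hv, hvd⟩ := hcl.exists_infDist_eq_dist ⟨w, hw⟩ (0 : Vec d)
  refine ⟨v, hv, fun z hz => ?_⟩
  have := Metric.infDist_le_dist_of_mem (x := (0 : Vec d)) (show z ∈ {v | Separates r y v} from hz)
  rw [hvd] at this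
  simpa using this

lemma attn_pos (X : Tokens d) (p : Vec d) (j : Fin 2) : 0 < attn X p j := by
  unfold attn softmax; positivity

lemma attn_add (X : Tokens d) (p : Vec d) : attn X p 0 + attn X p 1 = 1 := by
  unfold attn softmax
  rw [← add_div, ← Fin.sum_univ_two (f := fun k => Real.exp (inner ℝ (X k) p)), div_self]
  positivity

lemma inner_attnOutput (X : Tokens d) (p v : Vec d) :
    inner ℝ v (attnOutput X p) = attn X p 0 * inner ℝ v (X 0) + attn X p 1 * inner ℝ v (X 1) := by
  simp [attnOutput, inner_add_right, real_inner_smul_right]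

end Existence

/-! ### The margin gap on a typical training set. -/

section Deterministic

variable {d n : ℕ}

open Classical in
/-- The clean samples with label `s`. -/
noncomputable def cleanWith (S : Fin n → Sample d) (s : ℝ) : Finset (Fin n) :=
  {i | IsClean (S i) ∧ label (S i) = s}

open Classical in
/-- The noisy samples. -/
noncomputable def noisy (S : Fin n → Sample d) : Finset (Fin n) := {i | ¬ IsClean (S i)}

/-- The properties that hold for almost every data point. -/
structure Regular (μ₁ μ₂ : Vec d) (z : Sample d) : Prop where
  trueLabel_eq : trueLabel z = 1 ∨ trueLabel z = -1
  label_eq : label z = 1 ∨ label z = -1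
  signal_eq : tokens z 0 = signal μ₁ μ₂ (trueLabel z)
  inner_left : inner ℝ μ₁ (tokens z 1) = 0
  inner_right : inner ℝ μ₂ (tokens z 1) = 0

/-- The properties of a typical training set. -/
structure Typical (μ₁ μ₂ : Vec d) (S : Fin n → Sample d) : Prop where
  regular : ∀ i, Regular μ₁ μ₂ (S i)
  noise : NearOrthogonal (fun i => tokens (S i) 1) d
  card_pos : (n : ℝ) ≤ 8 * (cleanWith S 1).card
  card_neg : (n : ℝ) ≤ 8 * (cleanWith S (-1)).card
  card_noisy : 10000 * ((noisy S).card : ℝ) ≤ n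

/-- The classifier with signal coefficients `a`, `b` and noise component `u`. -/
noncomputable def compose (ρ : ℝ) (μ₁ μ₂ : Vec d) (a b : ℝ) (u : Vec d) : Vec d :=
  (a / ρ ^ 2) • μ₁ - (b / ρ ^ 2) • μ₂ + u

variable {ρ : ℝ} {μ₁ μ₂ : Vec d}

section Compose

variable {a b : ℝ} {u x : Vec d}

lemma inner_compose_left (hρ : 0 < ρ) (h₁ : ‖μ₁‖ = ρ) (h₁₂ : inner ℝ μ₁ μ₂ = 0)
    (hu : inner ℝ μ₁ u = 0) : inner ℝ (compose ρ μ₁ μ₂ a b u) μ₁ = a := by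
  rw [real_inner_comm, compose, inner_add_right, inner_sub_right, real_inner_smul_right,
    real_inner_smul_right, h₁₂, hu, real_inner_self_eq_norm_sq, h₁]
  field_simp; ring

lemma inner_compose_right (hρ : 0 < ρ) (h₂ : ‖μ₂‖ = ρ) (h₁₂ : inner ℝ μ₁ μ₂ = 0)
    (hu : inner ℝ μ₂ u = 0) : inner ℝ (compose ρ μ₁ μ₂ a b u) μ₂ = -b := by
  rw [real_inner_comm, compose, inner_add_right, inner_sub_right, real_inner_smul_right,
    real_inner_smul_right, real_inner_comm, h₁₂, hu, real_inner_self_eq_norm_sq, h₂]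
  field_simp; ring

lemma inner_compose (hx₁ : inner ℝ μ₁ x = 0) (hx₂ : inner ℝ μ₂ x = 0) :
    inner ℝ (compose ρ μ₁ μ₂ a b u) x = inner ℝ u x := by
  rw [compose, inner_add_left, inner_sub_left, real_inner_smul_left, real_inner_smul_left, hx₁, hx₂]
  ring

lemma norm_compose_sq (hρ : 0 < ρ) (h₁ : ‖μ₁‖ = ρ) (h₂ : ‖μ₂‖ = ρ) (h₁₂ : inner ℝ μ₁ μ₂ = 0)
    (hu₁ : inner ℝ μ₁ u = 0) (hu₂ : inner ℝ μ₂ u = 0) :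
    ‖compose ρ μ₁ μ₂ a b u‖ ^ 2 = (a ^ 2 + b ^ 2) / ρ ^ 2 + ‖u‖ ^ 2 := by
  rw [← real_inner_self_eq_norm_sq]
  nth_rw 2 [compose]
  rw [inner_add_right, inner_sub_right, real_inner_smul_right, real_inner_smul_right,
    inner_compose_left hρ h₁ h₁₂ hu₁, inner_compose_right hρ h₂ h₁₂ hu₂, inner_compose hu₁ hu₂,
    real_inner_self_eq_norm_sq]
  field_simp; ring

/-- Every vector is composed of its signal coefficients and its noise component. -/
lemma exists_compose_eq (hρ : 0 < ρ) (h₁ : ‖μ₁‖ = ρ) (h₂ : ‖μ₂‖ = ρ) (h₁₂ : inner ℝ μ₁ μ₂ = 0)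
    (v : Vec d) : ∃ u, inner ℝ μ₁ u = 0 ∧ inner ℝ μ₂ u = 0 ∧
      v = compose ρ μ₁ μ₂ (inner ℝ v μ₁) (-inner ℝ v μ₂) u := by
  have e₁ := real_inner_self_eq_norm_sq μ₁
  have e₂ := real_inner_self_eq_norm_sq μ₂
  have h₂₁ : inner ℝ μ₂ μ₁ = 0 := by rw [real_inner_comm, h₁₂]
  refine ⟨v - (inner ℝ v μ₁ / ρ ^ 2) • μ₁ - (inner ℝ v μ₂ / ρ ^ 2) • μ₂, ?_, ?_, ?_⟩
  · simp only [inner_sub_right, real_inner_smul_right, e₁, h₁, h₁₂, real_inner_comm v μ₁]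
    field_simp; ring
  · simp only [inner_sub_right, real_inner_smul_right, e₂, h₂, h₂₁, real_inner_comm v μ₂]
    field_simp; ring
  · simp only [compose, neg_div, neg_smul]; abel

end Compose

variable {S : Fin n → Sample d}

lemma Regular.trueLabel_eq_neg {z : Sample d} (h : Regular μ₁ μ₂ z) (hz : ¬ IsClean z) :
    trueLabel z = -label z := by
  unfold IsClean at hz
  rcases h.trueLabel_eq with h1 | h1 <;> rcases h.label_eq with h2 | h2 <;> rw [h1, h2] at hz ⊢ <;>
    first | exact absurd rfl hz | norm_num

/-- The signed signal margin of a sample. -/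
lemma Regular.trueLabel_mul_inner {z : Sample d} (h : Regular μ₁ μ₂ z) (v : Vec d) :
    trueLabel z * inner ℝ v (tokens z 0) =
      if trueLabel z = 1 then inner ℝ v μ₁ else -inner ℝ v μ₂ := by
  rw [h.signal_eq, signal]
  rcases h.trueLabel_eq with h1 | h1
  · simp [h1]
  · have : (-1 : ℝ) ≠ 1 := by norm_num
    simp [h1, this]

/-- The deviation of one sample from the optimal token. -/
noncomputable def dev (z : Sample d) (p : Vec d) : ℝ := 1 - attn (tokens z) p (optIndex z)

lemma dev_pos (z : Sample d) (p : Vec d) : 0 < dev z p := by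
  have h0 := attn_pos (tokens z) p 0
  have h1 := attn_pos (tokens z) p 1
  have h := attn_add (tokens z) p
  unfold dev optIndex
  split_ifs <;> linarith

lemma dev_lt_one (z : Sample d) (p : Vec d) : dev z p < 1 := by
  have := attn_pos (tokens z) p (optIndex z)
  unfold dev; linarith

lemma label_mul_inner_clean {z : Sample d} (hz : IsClean z) (p v : Vec d) :
    label z * inner ℝ v (attnOutput (tokens z) p) =
      (1 - dev z p) * (trueLabel z * inner ℝ v (tokens z 0)) +
        dev z p * (label z * inner ℝ v (tokens z 1)) := by
  have h := attn_add (tokens z) p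
  have h1 : dev z p = attn (tokens z) p 1 := by rw [dev, optIndex, if_pos hz]; linarith
  have h2 : 1 - dev z p = attn (tokens z) p 0 := by linarith
  rw [inner_attnOutput, h2, h1, show trueLabel z = label z from hz]
  ring

/-- Since the label is flipped, the signal enters with a minus sign: attention on it works against
the observed label. -/
lemma label_mul_inner_noisy {z : Sample d} (hz : ¬ IsClean z) (h : trueLabel z = -label z)
    (p v : Vec d) :
    label z * inner ℝ v (attnOutput (tokens z) p) =
      (1 - dev z p) * (label z * inner ℝ v (tokens z 1)) -
        dev z p * (trueLabel z * inner ℝ v (tokens z 0)) := by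
  have h' := attn_add (tokens z) p
  have h1 : dev z p = attn (tokens z) p 0 := by rw [dev, optIndex, if_neg hz]; linarith
  have h2 : 1 - dev z p = attn (tokens z) p 1 := by linarith
  rw [inner_attnOutput, h2, h1, h]
  ring

lemma mem_cleanWith {s : ℝ} {i : Fin n} :
    i ∈ cleanWith S s ↔ IsClean (S i) ∧ label (S i) = s := by simp [cleanWith]

lemma mem_noisy {i : Fin n} : i ∈ noisy S ↔ ¬ IsClean (S i) := by simp [noisy]

/-- This makes the optimal-token problem separate into signal coefficients and a noise component;
combined with minimality of v_mm it yields the upper bound on its norm. -/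
lemma Typical.separates_opt (hS : Typical μ₁ μ₂ S) (hρ : 0 < ρ) (h₁ : ‖μ₁‖ = ρ) (h₂ : ‖μ₂‖ = ρ)
    (h₁₂ : inner ℝ μ₁ μ₂ = 0) {a b : ℝ} {u : Vec d} (hu₁ : inner ℝ μ₁ u = 0)
    (hu₂ : inner ℝ μ₂ u = 0) (ha : 1 ≤ a) (hb : 1 ≤ b)
    (hu : ∀ i ∈ noisy S, 1 ≤ label (S i) * inner ℝ u (tokens (S i) 1)) :
    Separates (fun i => optToken (S i)) (fun i => label (S i)) (compose ρ μ₁ μ₂ a b u) := by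
  intro i
  have hi := hS.regular i
  by_cases hc : IsClean (S i)
  · have := hi.trueLabel_mul_inner (compose ρ μ₁ μ₂ a b u)
    rw [inner_compose_left hρ h₁ h₁₂ hu₁, inner_compose_right hρ h₂ h₁₂ hu₂, neg_neg] at this
    simp only [optToken, optIndex, if_pos hc]
    rw [← show trueLabel (S i) = label (S i) from hc, this]
    split_ifs <;> assumption
  · simp only [optToken, optIndex, if_neg hc]
    rw [inner_compose hi.inner_left hi.inner_right]
    exact hu i (mem_noisy.2 hc)

lemma Typical.exists_isSVMOpt (hS : Typical μ₁ μ₂ S) (hd : 0 < d) (hρ : 0 < ρ) (h₁ : ‖μ₁‖ = ρ)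
    (h₂ : ‖μ₂‖ = ρ) (h₁₂ : inner ℝ μ₁ μ₂ = 0) : ∃ v, IsSVMOpt S v := by
  have hd' : (0 : ℝ) < d := by exact_mod_cast hd
  refine exists_isSVM (hS.separates_opt hρ h₁ h₂ h₁₂
    (u := (8 / (d : ℝ)) • ∑ j ∈ noisy S, label (S j) • tokens (S j) 1) ?_ ?_ le_rfl le_rfl ?_)
  · rw [real_inner_smul_right, inner_sum]
    simp [real_inner_smul_right, (hS.regular _).inner_left]
  · rw [real_inner_smul_right, inner_sum]
    simp [real_inner_smul_right, (hS.regular _).inner_right]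
  · intro i hi
    rw [real_inner_smul_left, mul_left_comm]
    calc (1 : ℝ) = 8 / d * (d / 8) := by field_simp
      _ ≤ _ := by
        gcongr
        exact hS.noise.le_inner_sum hd' (fun i => (hS.regular i).label_eq) hi

/-- The signed sum of all noise tokens is orthogonal to both signals and fits every noise token.
Softmax weights are positive, so a multiple depending on p makes up for small attention on the
noise; T dominates each reciprocal weight. -/
lemma Typical.exists_isSVMAt (hS : Typical μ₁ μ₂ S) (hd : 0 < d) (p : Vec d) :
    ∃ v, IsSVMAt S p v := by
  have hd' : (0 : ℝ) < d := by exact_mod_cast hd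
  set w : Vec d := ∑ j, label (S j) • tokens (S j) 1 with hw
  have hw₁ : inner ℝ w μ₁ = 0 := by
    rw [real_inner_comm, hw, inner_sum]
    simp [real_inner_smul_right, (hS.regular _).inner_left]
  have hw₂ : inner ℝ w μ₂ = 0 := by
    rw [real_inner_comm, hw, inner_sum]
    simp [real_inner_smul_right, (hS.regular _).inner_right]
  set T : ℝ := ∑ j, (attn (tokens (S j)) p 1)⁻¹ with hT
  have hTi : ∀ i, (attn (tokens (S i)) p 1)⁻¹ ≤ T := fun i =>
    Finset.single_le_sum (f := fun j => (attn (tokens (S j)) p 1)⁻¹)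
      (fun j _ => (inv_pos.2 (attn_pos _ _ _)).le) (Finset.mem_univ i)
  refine exists_isSVM (w := (T * (8 / d)) • w) fun i => ?_
  have hi := hS.regular i
  have hs := attn_pos (tokens (S i)) p 1
  have h0 : inner ℝ w (tokens (S i) 0) = 0 := by
    rw [hi.signal_eq, signal]; split_ifs <;> assumption
  have h1 : (d : ℝ) / 8 ≤ label (S i) * inner ℝ w (tokens (S i) 1) :=
    hS.noise.le_inner_sum hd' (fun i => (hS.regular i).label_eq) (Finset.mem_univ i)
  rw [inner_attnOutput, real_inner_smul_left, real_inner_smul_left, h0]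
  calc (1 : ℝ) = ((attn (tokens (S i)) p 1)⁻¹ * (8 / d)) * attn (tokens (S i)) p 1 * (d / 8) := by
        field_simp
    _ ≤ (T * (8 / d)) * attn (tokens (S i)) p 1 * (label (S i) * inner ℝ w (tokens (S i) 1)) := by
        gcongr
        · exact mul_nonneg (mul_nonneg ((inv_pos.2 hs).le.trans (hTi i)) (by positivity)) hs.le
        · exact hTi i
    _ = _ := by ring

/-- On a typical training set, deviating from the optimal tokens increases the squared norm of the
max-margin classifier. -/
theorem Typical.norm_sq_gap (hS : Typical μ₁ μ₂ S) (hd : 0 < d) (hρ : 0 < ρ) (h₁ : ‖μ₁‖ = ρ)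
    (h₂ : ‖μ₂‖ = ρ) (h₁₂ : inner ℝ μ₁ μ₂ = 0) (hρn : 1000 * (d : ℝ) ≤ n * ρ ^ 2)
    {vmm v p : Vec d} (hvmm : IsSVMOpt S vmm) (hv : IsSVMAt S p v) (k : Fin n) :
    ‖vmm‖ ^ 2 + dev (S k) p / (n * ρ ^ 2) ≤ ‖v‖ ^ 2 := by
  have hd' : (0 : ℝ) < d := by exact_mod_cast hd
  obtain ⟨u, hu₁, hu₂, hvu⟩ := exists_compose_eq hρ h₁ h₂ h₁₂ v
  set a := inner ℝ v μ₁ with ha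
  set b := -inner ℝ v μ₂ with hb
  have hmem : ∀ x : Vec d, x ∈ (ℝ ∙ μ₁)ᗮ ⊓ (ℝ ∙ μ₂)ᗮ ↔ inner ℝ μ₁ x = 0 ∧ inner ℝ μ₂ x = 0 := by
    intro x
    rw [Submodule.mem_inf, Submodule.mem_orthogonal_singleton_iff_inner_right,
      Submodule.mem_orthogonal_singleton_iff_inner_right]
  have hnoise : ∀ i, inner ℝ v (tokens (S i) 1) = inner ℝ u (tokens (S i) 1) := fun i => by
    rw [hvu, inner_compose (hS.regular i).inner_left (hS.regular i).inner_right]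
  have hclean : ∀ i, IsClean (S i) →
      1 ≤ (1 - dev (S i) p) * (if trueLabel (S i) = 1 then a else b) +
      dev (S i) p * (label (S i) * inner ℝ u (tokens (S i) 1)) := by
    intro i hi
    have := hv.1 i
    rwa [label_mul_inner_clean hi, (hS.regular i).trueLabel_mul_inner, hnoise] at this
  rw [hvu, norm_compose_sq hρ h₁ h₂ h₁₂ hu₁ hu₂]
  -- The noise component stays in the orthogonal complement of both signals, so that altering it
  -- leaves the signal margins unchanged.
  refine TokenSelection.norm_sq_gap hS.noise hd' (fun i => (hS.regular i).label_eq)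
    ((ℝ ∙ μ₁)ᗮ ⊓ (ℝ ∙ μ₂)ᗮ) (fun i => (hmem _).2 ⟨(hS.regular i).inner_left,
      (hS.regular i).inner_right⟩) (cleanWith S 1) (cleanWith S (-1)) (noisy S) hρ hρn
    hS.card_pos hS.card_neg hS.card_noisy ?_ ((hmem u).2 ⟨hu₁, hu₂⟩)
    (β := fun i => dev (S i) p) (fun i => dev_pos _ _) (fun i => dev_lt_one _ _) ?_ ?_ ?_ ?_ k
  · intro a' b' u' hu' ha' hb' hN
    obtain ⟨hu'₁, hu'₂⟩ := (hmem u').1 hu'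
    rw [← norm_compose_sq hρ h₁ h₂ h₁₂ hu'₁ hu'₂]
    have := hvmm.2 _ (hS.separates_opt hρ h₁ h₂ h₁₂ hu'₁ hu'₂ ha' hb' hN)
    gcongr
  · intro i hi
    obtain ⟨hc, hl⟩ := mem_cleanWith.1 hi
    have := hclean i hc
    rwa [if_pos ((show trueLabel (S i) = label (S i) from hc).trans hl)] at this
  · intro i hi
    obtain ⟨hc, hl⟩ := mem_cleanWith.1 hi
    have := hclean i hc
    rwa [if_neg (by rw [show trueLabel (S i) = label (S i) from hc, hl]; norm_num)] at this
  · intro i hi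
    have hc := mem_noisy.1 hi
    have := hv.1 i
    rw [label_mul_inner_noisy hc ((hS.regular i).trueLabel_eq_neg hc),
      (hS.regular i).trueLabel_mul_inner, hnoise] at this
    split_ifs at this
    · exact Or.inl this
    · exact Or.inr this
  · intro i
    by_cases hc : IsClean (S i)
    · rcases (hS.regular i).label_eq with h | h
      · exact Or.inl (mem_cleanWith.2 ⟨hc, h⟩)
      · exact Or.inr (Or.inl (mem_cleanWith.2 ⟨hc, h⟩))
    · exact Or.inr (Or.inr (mem_noisy.2 hc))

/-- Some clean sample has signal μ₁, and Cauchy–Schwarz applies to its constraint. This ensures v_mm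
≠ 0 and that the gap is at most ‖v_mm‖², as `one_div_le_of_sq_gap` requires. -/
lemma Typical.one_le_norm_mul (hS : Typical μ₁ μ₂ S) (hn : 0 < n) (h₁ : ‖μ₁‖ = ρ)
    {vmm : Vec d} (hvmm : IsSVMOpt S vmm) : 1 ≤ ‖vmm‖ * ρ := by
  have hn' : (0 : ℝ) < n := by exact_mod_cast hn
  have hpos : 0 < (cleanWith S 1).card := by
    have := hS.card_pos
    exact_mod_cast (by linarith : (0 : ℝ) < (cleanWith S 1).card)
  obtain ⟨i, hi⟩ := Finset.card_pos.1 hpos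
  obtain ⟨hc, hl⟩ := mem_cleanWith.1 hi
  have h := hvmm.1 i
  have ht : trueLabel (S i) = 1 := (show trueLabel (S i) = label (S i) from hc).trans hl
  simp only [optToken, optIndex, if_pos hc, hl, one_mul, (hS.regular i).signal_eq, signal, ht,
    if_true] at h
  exact (h.trans (real_inner_le_norm _ _)).trans_eq (by rw [h₁])

/-- The margin gap on a typical training set. -/
theorem Typical.labelMargin_le (hS : Typical μ₁ μ₂ S) (hd : 0 < d) (hn : 0 < n) (hρ : 0 < ρ)
    (h₁ : ‖μ₁‖ = ρ) (h₂ : ‖μ₂‖ = ρ) (h₁₂ : inner ℝ μ₁ μ₂ = 0)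
    (hρn : 1000 * (d : ℝ) ≤ n * ρ ^ 2) {vmm v p : Vec d} (hvmm : IsSVMOpt S vmm)
    (hv : IsSVMAt S p v) :
    labelMargin v ≤ labelMargin vmm - 1 / 4 / (‖vmm‖ ^ 3 * n * ρ ^ 2) * deviation S p := by
  have : Nonempty (Fin n) := ⟨⟨0, hn⟩⟩
  have hn1 : (1 : ℝ) ≤ n := by exact_mod_cast hn
  -- The gap holds for every sample, in particular for one attaining the maximal deviation.
  obtain ⟨k, hk⟩ := exists_eq_ciSup_of_finite (f := fun i => dev (S i) p)
  have hdev : deviation S p = dev (S k) p := hk.symm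
  have hw1 := hS.one_le_norm_mul hn h₁ hvmm
  have hw : 0 < ‖vmm‖ := pos_of_mul_pos_left (by linarith) hρ.le
  have hgap := hS.norm_sq_gap hd hρ h₁ h₂ h₁₂ hρn hvmm hv k
  have hβ := dev_pos (S k) p
  have hx0 : 0 < dev (S k) p / (n * ρ ^ 2) := by positivity
  have hx1 : dev (S k) p / (n * ρ ^ 2) ≤ ‖vmm‖ ^ 2 := by
    rw [div_le_iff₀ (by positivity)]
    have h3 : 1 ≤ (‖vmm‖ * ρ) ^ 2 := one_le_pow₀ hw1
    have h4 := mul_le_mul hn1 h3 zero_le_one (by linarith)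
    have := (dev_lt_one (S k) p).le
    calc dev (S k) p ≤ n * (‖vmm‖ * ρ) ^ 2 := by linarith
      _ = _ := by ring
  have hv0 : 0 < ‖v‖ := by
    refine (norm_nonneg v).lt_of_ne fun h => ?_
    rw [← h] at hgap
    nlinarith
  refine (one_div_le_of_sq_gap hw hv0 hx0.le hx1 hgap).trans_eq ?_
  rw [hdev, labelMargin]
  congr 1
  field_simp

end Deterministic

/-! ### Concentration of the standard Gaussian. -/

section Gaussian

/-- The moment generating function of the square of a standard Gaussian variable. -/
lemma integral_exp_mul_sq_gaussianReal {t : ℝ} (ht : t < 1 / 2) :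
    ∫ x, Real.exp (t * x ^ 2) ∂gaussianReal 0 1 = (Real.sqrt (1 - 2 * t))⁻¹ := by
  rw [integral_gaussianReal_eq_integral_smul one_ne_zero]
  have h1 : ∀ x : ℝ, gaussianPDFReal 0 1 x • Real.exp (t * x ^ 2) =
      (Real.sqrt (2 * Real.pi))⁻¹ * Real.exp (-(1 / 2 - t) * x ^ 2) := fun x => by
    rw [gaussianPDFReal, smul_eq_mul, mul_assoc, ← Real.exp_add]
    simp only [NNReal.coe_one, mul_one, sub_zero]
    congr 2; ring
  simp_rw [h1]
  rw [integral_const_mul, integral_gaussian, ← Real.sqrt_inv, ← Real.sqrt_inv,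
    ← Real.sqrt_mul (by positivity)]
  congr 1
  have : 1 - 2 * t ≠ 0 := by linarith
  have : 1 / 2 - t ≠ 0 := by linarith
  have := Real.pi_ne_zero
  field_simp

lemma integral_exp_mul_norm_sq_stdGaussian (d : ℕ) {t : ℝ} (ht : t < 1 / 2) :
    ∫ z, Real.exp (t * ‖z‖ ^ 2) ∂stdGaussian (Vec d) = ((Real.sqrt (1 - 2 * t))⁻¹) ^ d := by
  rw [← map_pi_eq_stdGaussian, integral_map (by fun_prop) (by fun_prop)]
  simp_rw [EuclideanSpace.real_norm_sq_eq, Finset.mul_sum, Real.exp_sum]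
  rw [integral_fintype_prod_eq_prod (f := fun _ x => Real.exp (t * x ^ 2))]
  simp [integral_exp_mul_sq_gaussianReal ht]

/-- A Bochner integral that is not zero can only come from an integrable function. -/
lemma integrable_exp_mul_norm_sq_stdGaussian (d : ℕ) {t : ℝ} (ht : t < 1 / 2) :
    Integrable (fun z => Real.exp (t * ‖z‖ ^ 2)) (stdGaussian (Vec d)) := by
  refine Integrable.of_integral_ne_zero ?_
  rw [integral_exp_mul_norm_sq_stdGaussian d ht]
  have : 0 < 1 - 2 * t := by linarith
  positivity

/-- Chernoff bound at t = 1/4: the exponent is −d/2 + (d/2) log 2, and (log 2)/2 ≤ 7/16. -/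
lemma stdGaussian_norm_sq_ge (d : ℕ) :
    (stdGaussian (Vec d)).real {z | 2 * (d : ℝ) ≤ ‖z‖ ^ 2} ≤ Real.exp (-(d / 16)) := by
  refine (measure_ge_le_exp_mul_mgf (X := fun z : Vec d => ‖z‖ ^ 2) (2 * (d : ℝ)) (t := 1 / 4)
    (by norm_num) (integrable_exp_mul_norm_sq_stdGaussian d (by norm_num))).trans ?_
  rw [mgf, integral_exp_mul_norm_sq_stdGaussian d (by norm_num), ← Real.sqrt_inv]
  have h2 : Real.sqrt (1 - 2 * (1 / 4))⁻¹ ≤ Real.exp (7 / 16) := by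
    rw [Real.sqrt_le_left (by positivity), ← Real.exp_nat_mul]
    have := Real.log_two_lt_d9
    rw [← Real.log_le_iff_le_exp (by norm_num)]
    norm_num
    linarith
  calc Real.exp (-(1 / 4) * (2 * d)) * Real.sqrt (1 - 2 * (1 / 4))⁻¹ ^ d
      ≤ Real.exp (-(1 / 4) * (2 * d)) * Real.exp (7 / 16) ^ d := by gcongr
    _ = _ := by rw [← Real.exp_nat_mul, ← Real.exp_add]; congr 1; ring

/-- Chernoff bound at t = −1/2: the exponent is d/4 − (d/2) log 2, and (log 2)/2 ≥ 5/16. -/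
lemma stdGaussian_norm_sq_le (d : ℕ) :
    (stdGaussian (Vec d)).real {z | ‖z‖ ^ 2 ≤ (d : ℝ) / 2} ≤ Real.exp (-(d / 16)) := by
  refine (measure_le_le_exp_mul_mgf (X := fun z : Vec d => ‖z‖ ^ 2) ((d : ℝ) / 2) (t := -(1 / 2))
    (by norm_num) (integrable_exp_mul_norm_sq_stdGaussian d (by norm_num))).trans ?_
  rw [mgf, integral_exp_mul_norm_sq_stdGaussian d (by norm_num), ← Real.sqrt_inv]
  have h2 : Real.sqrt (1 - 2 * (-(1 / 2)))⁻¹ ≤ Real.exp (-(5 / 16)) := by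
    rw [Real.sqrt_le_left (by positivity), ← Real.exp_nat_mul]
    have := Real.log_two_gt_d9
    rw [← Real.log_le_iff_le_exp (by norm_num), Real.log_inv]
    norm_num
    linarith
  calc Real.exp (-(-(1 / 2)) * (d / 2)) * Real.sqrt (1 - 2 * (-(1 / 2)))⁻¹ ^ d
      ≤ Real.exp (-(-(1 / 2)) * (d / 2)) * Real.exp (-(5 / 16)) ^ d := by gcongr
    _ = _ := by rw [← Real.exp_nat_mul, ← Real.exp_add]; congr 1; ring

lemma hasSubgaussianMGF_inner_stdGaussian {d : ℕ} (w : Vec d) {σ : ℝ} (hσ : ‖w‖ ^ 2 ≤ σ) :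
    HasSubgaussianMGF (fun z : Vec d => inner ℝ w z) σ.toNNReal (stdGaussian (Vec d)) := by
  have hmap : (stdGaussian (Vec d)).map (fun z => inner ℝ w z) =
      gaussianReal 0 (‖w‖ ^ 2).toNNReal := by
    have := IsGaussian.map_eq_gaussianReal (μ := stdGaussian (Vec d)) (innerSL ℝ w)
    rw [integral_strongDual_stdGaussian, variance_dual_stdGaussian, innerSL_apply_norm] at this
    exact this
  have hmeas : AEMeasurable (fun z : Vec d => inner ℝ w z) (stdGaussian (Vec d)) := by fun_prop
  refine ⟨fun t => ?_, fun t => ?_⟩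
  · have h := integrable_exp_mul_gaussianReal (μ := 0) (v := (‖w‖ ^ 2).toNNReal) t
    rw [← hmap] at h
    exact (integrable_map_measure (by fun_prop) hmeas).1 h
  · rw [mgf_gaussianReal hmap, Real.coe_toNNReal _ (sq_nonneg _),
      Real.coe_toNNReal _ ((sq_nonneg _).trans hσ)]
    rw [zero_mul, zero_add]
    gcongr

lemma stdGaussian_abs_inner_ge {d : ℕ} (w : Vec d) {σ t : ℝ} (hσ : ‖w‖ ^ 2 ≤ σ) (ht : 0 ≤ t) :
    (stdGaussian (Vec d)).real {z | t ≤ |inner ℝ w z|} ≤ 2 * Real.exp (-t ^ 2 / (2 * σ)) := by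
  have h := hasSubgaussianMGF_inner_stdGaussian w hσ
  have h1 := h.measure_ge_le ht
  have h2 := h.neg.measure_ge_le ht
  rw [Real.coe_toNNReal _ ((sq_nonneg _).trans hσ)] at h1 h2
  calc _ ≤ (stdGaussian (Vec d)).real ({z | t ≤ inner ℝ w z} ∪ {z | t ≤ -inner ℝ w z}) := by
        refine measureReal_mono fun z hz => ?_
        have hz' : t ≤ |inner ℝ w z| := hz
        exact le_abs.1 hz'
    _ ≤ _ := measureReal_union_le _ _
    _ ≤ _ := by rw [two_mul]; exact add_le_add h1 h2

end Gaussian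

/-! ### The noise as a projected standard Gaussian. -/

section NoiseLaw

variable {d : ℕ} {ρ : ℝ} {μ₁ μ₂ : Vec d}

/-- The orthogonal projection that maps standard Gaussian vectors to noise vectors. -/
noncomputable def noiseProj (ρ : ℝ) (μ₁ μ₂ z : Vec d) : Vec d :=
  z - (inner ℝ μ₁ z / ρ ^ 2) • μ₁ - (inner ℝ μ₂ z / ρ ^ 2) • μ₂

lemma toEuclideanCLM_noiseCov (z : Vec d) :
    Matrix.toEuclideanCLM (𝕜 := ℝ) (noiseCov ρ μ₁ μ₂) z = noiseProj ρ μ₁ μ₂ z := by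
  unfold noiseProj
  ext i
  rw [Matrix.ofLp_toEuclideanCLM, noiseCov, Matrix.sub_mulVec, Matrix.sub_mulVec,
    Matrix.smul_mulVec, Matrix.smul_mulVec, Matrix.vecMulVec_mulVec, Matrix.vecMulVec_mulVec]
  simp [PiLp.inner_apply, dotProduct, mul_comm, div_eq_mul_inv]
  ring

lemma noiseCov_mul_self (hρ : 0 < ρ) (h₁ : ‖μ₁‖ = ρ) (h₂ : ‖μ₂‖ = ρ) (h₁₂ : inner ℝ μ₁ μ₂ = 0) :
    noiseCov ρ μ₁ μ₂ * noiseCov ρ μ₁ μ₂ = noiseCov ρ μ₁ μ₂ := by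
  refine EquivLike.injective (Matrix.toEuclideanCLM (n := Fin d) (𝕜 := ℝ)) ?_
  rw [map_mul]
  ext1 z
  rw [mul_apply_eq_comp]
  simp only [toEuclideanCLM_noiseCov, noiseProj]
  have h₂₁ : inner ℝ μ₂ μ₁ = 0 := by rw [real_inner_comm, h₁₂]
  simp only [inner_sub_right, real_inner_smul_right, real_inner_self_eq_norm_sq, h₁, h₂, h₁₂, h₂₁]
  field_simp
  simp

lemma noiseCov_transpose : (noiseCov ρ μ₁ μ₂).conjTranspose = noiseCov ρ μ₁ μ₂ := by
  rw [noiseCov, Matrix.conjTranspose_sub, Matrix.conjTranspose_sub,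
    Matrix.conjTranspose_smul, Matrix.conjTranspose_smul,
    Matrix.conjTranspose_vecMulVec, Matrix.conjTranspose_vecMulVec]
  simp

-- The covariance is an orthogonal projection, hence its own positive square root.
open scoped MatrixOrder in
lemma noiseLaw_eq_map (hρ : 0 < ρ) (h₁ : ‖μ₁‖ = ρ) (h₂ : ‖μ₂‖ = ρ) (h₁₂ : inner ℝ μ₁ μ₂ = 0) :
    noiseLaw ρ μ₁ μ₂ = (stdGaussian (Vec d)).map (noiseProj ρ μ₁ μ₂) := by
  have hpos : (noiseCov ρ μ₁ μ₂).PosSemidef := by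
    have := Matrix.posSemidef_conjTranspose_mul_self (noiseCov ρ μ₁ μ₂)
    rwa [noiseCov_transpose, noiseCov_mul_self hρ h₁ h₂ h₁₂] at this
  have hsqrt : CFC.sqrt (noiseCov ρ μ₁ μ₂) = noiseCov ρ μ₁ μ₂ :=
    CFC.sqrt_unique (noiseCov_mul_self hρ h₁ h₂ h₁₂) hpos.nonneg
  rw [noiseLaw, multivariateGaussian, hsqrt]
  simp only [toEuclideanCLM_noiseCov, zero_add]

lemma measurable_noiseProj : Measurable (noiseProj ρ μ₁ μ₂) := by
  unfold noiseProj; fun_prop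

lemma inner_noiseProj_left (hρ : 0 < ρ) (h₁ : ‖μ₁‖ = ρ) (h₁₂ : inner ℝ μ₁ μ₂ = 0) (z : Vec d) :
    inner ℝ μ₁ (noiseProj ρ μ₁ μ₂ z) = 0 := by
  simp only [noiseProj, inner_sub_right, real_inner_smul_right, real_inner_self_eq_norm_sq, h₁, h₁₂]
  field_simp; ring

lemma inner_noiseProj_right (hρ : 0 < ρ) (h₂ : ‖μ₂‖ = ρ) (h₁₂ : inner ℝ μ₁ μ₂ = 0) (z : Vec d) :
    inner ℝ μ₂ (noiseProj ρ μ₁ μ₂ z) = 0 := by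
  have h₂₁ : inner ℝ μ₂ μ₁ = 0 := by rw [real_inner_comm, h₁₂]
  simp only [noiseProj, inner_sub_right, real_inner_smul_right, real_inner_self_eq_norm_sq, h₂, h₂₁]
  field_simp; ring

lemma norm_noiseProj_sq (hρ : 0 < ρ) (h₁ : ‖μ₁‖ = ρ) (h₂ : ‖μ₂‖ = ρ) (h₁₂ : inner ℝ μ₁ μ₂ = 0)
    (z : Vec d) : ‖noiseProj ρ μ₁ μ₂ z‖ ^ 2 =
    ‖z‖ ^ 2 - (inner ℝ μ₁ z ^ 2 + inner ℝ μ₂ z ^ 2) / ρ ^ 2 := by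
  have e₁ := inner_noiseProj_left hρ h₁ h₁₂ z
  have e₂ := inner_noiseProj_right hρ h₂ h₁₂ z
  rw [← real_inner_self_eq_norm_sq]
  nth_rw 1 [noiseProj]
  rw [inner_sub_left, inner_sub_left, real_inner_smul_left, real_inner_smul_left, e₁, e₂, noiseProj,
    inner_sub_right, inner_sub_right, real_inner_smul_right, real_inner_smul_right,
    real_inner_self_eq_norm_sq, real_inner_comm μ₁ z, real_inner_comm μ₂ z]
  field_simp; ring

lemma norm_noiseProj_sq_le (hρ : 0 < ρ) (h₁ : ‖μ₁‖ = ρ) (h₂ : ‖μ₂‖ = ρ) (h₁₂ : inner ℝ μ₁ μ₂ = 0)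
    (z : Vec d) : ‖noiseProj ρ μ₁ μ₂ z‖ ^ 2 ≤ ‖z‖ ^ 2 := by
  rw [norm_noiseProj_sq hρ h₁ h₂ h₁₂]
  have : 0 ≤ (inner ℝ μ₁ z ^ 2 + inner ℝ μ₂ z ^ 2) / ρ ^ 2 := by positivity
  linarith

lemma ae_noiseLaw_inner_eq_zero (hρ : 0 < ρ) (h₁ : ‖μ₁‖ = ρ) (h₂ : ‖μ₂‖ = ρ)
    (h₁₂ : inner ℝ μ₁ μ₂ = 0)
    : ∀ᵐ x ∂noiseLaw ρ μ₁ μ₂, inner ℝ μ₁ x = 0 ∧ inner ℝ μ₂ x = 0 := by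
  rw [noiseLaw_eq_map hρ h₁ h₂ h₁₂, ae_map_iff measurable_noiseProj.aemeasurable]
  · exact ae_of_all _ fun z =>
      ⟨inner_noiseProj_left hρ h₁ h₁₂ z, inner_noiseProj_right hρ h₂ h₁₂ z⟩
  · exact (measurableSet_eq_fun (by fun_prop) (by fun_prop)).inter
      (measurableSet_eq_fun (by fun_prop) (by fun_prop))

lemma noiseLaw_norm_sq_ge (hρ : 0 < ρ) (h₁ : ‖μ₁‖ = ρ) (h₂ : ‖μ₂‖ = ρ) (h₁₂ : inner ℝ μ₁ μ₂ = 0)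
    :
    (noiseLaw ρ μ₁ μ₂).real {x | 2 * (d : ℝ) ≤ ‖x‖ ^ 2} ≤ Real.exp (-(d / 16)) := by
  rw [noiseLaw_eq_map hρ h₁ h₂ h₁₂, map_measureReal_apply measurable_noiseProj
    (measurableSet_le (by fun_prop) (by fun_prop))]
  refine (measureReal_mono fun z hz => ?_).trans (stdGaussian_norm_sq_ge d)
  have hz' : 2 * (d : ℝ) ≤ ‖noiseProj ρ μ₁ μ₂ z‖ ^ 2 := hz
  exact hz'.trans (norm_noiseProj_sq_le hρ h₁ h₂ h₁₂ z)

/-- The projection removes two coordinates, each of square at most d/8 outside an event of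
probability 2exp(−d/16). The factor 5 counts these two events and the lower tail of ‖z‖². -/
lemma noiseLaw_norm_sq_le (hρ : 0 < ρ) (h₁ : ‖μ₁‖ = ρ) (h₂ : ‖μ₂‖ = ρ) (h₁₂ : inner ℝ μ₁ μ₂ = 0)
    :
    (noiseLaw ρ μ₁ μ₂).real {x | ‖x‖ ^ 2 ≤ (d : ℝ) / 4} ≤ 5 * Real.exp (-(d / 16)) := by
  rw [noiseLaw_eq_map hρ h₁ h₂ h₁₂, map_measureReal_apply measurable_noiseProj
    (measurableSet_le (by fun_prop) (by fun_prop))]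
  have ht : (0 : ℝ) ≤ ρ * Real.sqrt (d / 8) := by positivity
  have hsq : (ρ * Real.sqrt (d / 8)) ^ 2 = ρ ^ 2 * (d / 8) := by
    rw [mul_pow, Real.sq_sqrt (by positivity)]
  have hexp : -(ρ * Real.sqrt (d / 8)) ^ 2 / (2 * ρ ^ 2) = -(d / 16) := by
    rw [hsq]; field_simp; ring
  have k₁ := stdGaussian_abs_inner_ge μ₁ (σ := ρ ^ 2) (by rw [h₁]) ht
  have k₂ := stdGaussian_abs_inner_ge μ₂ (σ := ρ ^ 2) (by rw [h₂]) ht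
  have k := stdGaussian_norm_sq_le d
  rw [hexp] at k₁ k₂
  calc _ ≤ (stdGaussian (Vec d)).real ({z | ‖z‖ ^ 2 ≤ (d : ℝ) / 2} ∪
        ({z | ρ * Real.sqrt (d / 8) ≤ |inner ℝ μ₁ z|} ∪
          {z | ρ * Real.sqrt (d / 8) ≤ |inner ℝ μ₂ z|})) := by
        refine measureReal_mono fun z hz => ?_
        have hz' : ‖noiseProj ρ μ₁ μ₂ z‖ ^ 2 ≤ (d : ℝ) / 4 := hz
        rw [norm_noiseProj_sq hρ h₁ h₂ h₁₂] at hz'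
        by_contra hcon
        simp only [Set.mem_union, Set.mem_ofPred_eq, not_or, not_le] at hcon
        obtain ⟨c, c₁, c₂⟩ := hcon
        have e₁ := pow_lt_pow_left₀ c₁ (abs_nonneg _) two_ne_zero
        have e₂ := pow_lt_pow_left₀ c₂ (abs_nonneg _) two_ne_zero
        rw [sq_abs, hsq] at e₁ e₂
        have : (inner ℝ μ₁ z ^ 2 + inner ℝ μ₂ z ^ 2) / ρ ^ 2 ≤ d / 4 := by
          rw [div_le_iff₀ (by positivity)]; linarith
        linarith
    _ ≤ _ := (measureReal_union_le _ _).trans (add_le_add le_rfl (measureReal_union_le _ _))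
    _ ≤ _ := by linarith

/-- The projection is self-adjoint, so it can be moved onto w, where it does not increase the norm.
-/
lemma noiseLaw_abs_inner_ge (hρ : 0 < ρ) (h₁ : ‖μ₁‖ = ρ) (h₂ : ‖μ₂‖ = ρ) (h₁₂ : inner ℝ μ₁ μ₂ = 0)
    (w : Vec d) {σ t : ℝ} (hσ : ‖w‖ ^ 2 ≤ σ) (ht : 0 ≤ t) :
    (noiseLaw ρ μ₁ μ₂).real {x | t ≤ |inner ℝ w x|} ≤ 2 * Real.exp (-t ^ 2 / (2 * σ)) := by
  rw [noiseLaw_eq_map hρ h₁ h₂ h₁₂, map_measureReal_apply measurable_noiseProj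
    (measurableSet_le (by fun_prop) (by fun_prop))]
  have hw : ∀ z, inner ℝ w (noiseProj ρ μ₁ μ₂ z) = inner ℝ (noiseProj ρ μ₁ μ₂ w) z := fun z => by
    simp only [noiseProj, inner_sub_right, inner_sub_left, real_inner_smul_right,
      real_inner_smul_left, real_inner_comm w]
    ring
  refine (measureReal_mono fun z hz => ?_).trans (stdGaussian_abs_inner_ge
    (noiseProj ρ μ₁ μ₂ w) ((norm_noiseProj_sq_le hρ h₁ h₂ h₁₂ w).trans hσ) ht)
  have hz' : t ≤ |inner ℝ w (noiseProj ρ μ₁ μ₂ z)| := hz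
  rwa [hw] at hz'

end NoiseLaw

/-! ### Hoeffding's inequality for the number of samples in a set. -/

section Counting

variable {Ω : Type*} [MeasurableSpace Ω]

open Classical in
/-- The number of samples in `A` is unlikely to be much smaller than its mean. -/
lemma pi_card_le (μ : Measure Ω) [IsProbabilityMeasure μ] (n : ℕ) {A : Set Ω}
    (hA : MeasurableSet A) {q t : ℝ} (hq : q ≤ μ.real A) (ht : 0 ≤ t) :
    (Measure.pi fun _ : Fin n => μ).real
      {S | ((Finset.univ.filter fun i => S i ∈ A).card : ℝ) ≤ n * (q - t)} ≤
      Real.exp (-(2 * n * t ^ 2)) := by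
  -- The sign turns the lower tail of the count into an upper tail. Values in [−1, 0] give variance
  -- proxy 1/4.
  set X : Ω → ℝ := fun z => -(A.indicator 1 z) with hX
  have hXm : Measurable X := (measurable_one.indicator hA).neg
  have hXint : ∫ z, X z ∂μ = -μ.real A := by
    rw [hX, integral_neg, integral_indicator_one hA]
  have hXb : ∀ z, X z ∈ Set.Icc (-1 : ℝ) 0 := fun z => by
    by_cases hz : z ∈ A <;> simp [hX, hz]
  have hsub : HasSubgaussianMGF (fun z => X z - ∫ z, X z ∂μ) ((‖(0 : ℝ) - (-1)‖₊ / 2) ^ 2) μ :=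
    hasSubgaussianMGF_of_mem_Icc hXm.aemeasurable (ae_of_all _ hXb)
  have hsub' : ∀ i ∈ (Finset.univ : Finset (Fin n)), HasSubgaussianMGF
      (fun S : Fin n → Ω => X (S i) - ∫ z, X z ∂μ) ((‖(0 : ℝ) - (-1)‖₊ / 2) ^ 2)
      (Measure.pi fun _ => μ) := fun i _ => by
    have hmp := measurePreserving_eval (fun _ : Fin n => μ) i
    have := HasSubgaussianMGF.of_map (Y := Function.eval i) (X := fun z => X z - ∫ z, X z ∂μ)
      (μ := Measure.pi fun _ : Fin n => μ) hmp.measurable.aemeasurable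
      (by rw [hmp.map_eq]; exact hsub)
    exact this
  have hind : iIndepFun (fun i (S : Fin n → Ω) => X (S i) - ∫ z, X z ∂μ)
      (Measure.pi fun _ => μ) :=
    iIndepFun_pi (X := fun _ z => X z - ∫ z, X z ∂μ)
      (fun _ => (hXm.sub_const _).aemeasurable)
  have h := HasSubgaussianMGF.measure_sum_ge_le_of_iIndepFun hind hsub'
    (ε := n * t) (by positivity)
  refine (measureReal_mono fun S hS => ?_).trans (h.trans_eq ?_)
  · have hS' : ((Finset.univ.filter fun i => S i ∈ A).card : ℝ) ≤ n * (q - t) := hS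
    have hcard : ∑ i : Fin n, X (S i) = -((Finset.univ.filter fun i => S i ∈ A).card : ℝ) := by
      simp [hX, Set.indicator_apply]
    change n * t ≤ ∑ i : Fin n, (X (S i) - ∫ z, X z ∂μ)
    rw [Finset.sum_sub_distrib, hcard, hXint]
    simp only [Finset.sum_const, Finset.card_univ, Fintype.card_fin, nsmul_eq_mul]
    have := mul_le_mul_of_nonneg_left hq (Nat.cast_nonneg (α := ℝ) n)
    linarith
  · congr 1
    simp only [Finset.sum_const, Finset.card_univ, Fintype.card_fin, nsmul_eq_mul]
    rcases n.eq_zero_or_pos with rfl | hn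
    · simp
    · have : (0 : ℝ) < n := by exact_mod_cast hn
      push_cast
      norm_num
      field_simp
      norm_num

end Counting

/-! ### The law of one data point. -/

section DataLaw

variable {d n : ℕ} {ρ η : ℝ} {μ₁ μ₂ : Vec d}

instance : IsProbabilityMeasure uniformSign :=
  ⟨by simp [uniformSign, ENNReal.inv_two_add_inv_two]⟩

lemma isProbabilityMeasure_flipSign (h0 : 0 ≤ η) (h1 : η ≤ 1) :
    IsProbabilityMeasure (flipSign η) :=
  ⟨by
    simp only [flipSign, Measure.coe_add, Measure.coe_smul, Pi.add_apply, Pi.smul_apply,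
      measure_univ, smul_eq_mul, mul_one]
    rw [← ENNReal.ofReal_add (by linarith) h0]; simp⟩

instance : IsProbabilityMeasure (noiseLaw ρ μ₁ μ₂) := by
  unfold noiseLaw; infer_instance

lemma measurable_signal : Measurable (signal μ₁ μ₂) :=
  Measurable.ite (measurableSet_singleton 1) measurable_const measurable_const

lemma measurable_cleanSample :
    Measurable fun w : ℝ × Vec d => ((![signal μ₁ μ₂ w.1, w.2], w.1) : Tokens d × ℝ) := by
  refine Measurable.prodMk (measurable_pi_iff.2 fun j => ?_) measurable_fst
  fin_cases j
  · exact measurable_signal.comp measurable_fst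
  · exact measurable_snd

instance : IsProbabilityMeasure (cleanLaw ρ μ₁ μ₂) :=
  Measure.isProbabilityMeasure_map measurable_cleanSample.aemeasurable

lemma measurable_flip :
    Measurable fun w : (Tokens d × ℝ) × ℝ => ((w.1.1, w.1.2, w.2 * w.1.2) : Sample d) := by
  fun_prop

lemma isProbabilityMeasure_dataLaw (h0 : 0 ≤ η) (h1 : η ≤ 1) :
    IsProbabilityMeasure (dataLaw ρ η μ₁ μ₂) :=
  have := isProbabilityMeasure_flipSign h0 h1
  Measure.isProbabilityMeasure_map measurable_flip.aemeasurable

lemma measurable_tokens (j : Fin 2) : Measurable fun z : Sample d => tokens z j :=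
  (measurable_pi_apply j).comp measurable_fst

lemma measurable_trueLabel : Measurable (trueLabel : Sample d → ℝ) :=
  measurable_fst.comp measurable_snd

lemma measurable_label : Measurable (label : Sample d → ℝ) :=
  measurable_snd.comp measurable_snd

lemma measurePreserving_noise (h0 : 0 ≤ η) (h1 : η ≤ 1) :
    MeasurePreserving (fun z : Sample d => tokens z 1) (dataLaw ρ η μ₁ μ₂)
      (noiseLaw ρ μ₁ μ₂) := by
  have := isProbabilityMeasure_flipSign h0 h1
  refine ⟨measurable_tokens 1, ?_⟩
  rw [dataLaw, Measure.map_map (measurable_tokens 1) measurable_flip]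
  have h2 : ((fun z : Sample d => tokens z 1) ∘ fun w : (Tokens d × ℝ) × ℝ =>
      ((w.1.1, w.1.2, w.2 * w.1.2) : Sample d)) = (fun c : Tokens d × ℝ => c.1 1) ∘ Prod.fst := rfl
  have h3 : Measurable fun c : Tokens d × ℝ => c.1 1 :=
    (measurable_pi_apply 1).comp measurable_fst
  rw [h2, ← Measure.map_map h3 measurable_fst, Measure.map_fst_prod, measure_univ, one_smul,
    cleanLaw, Measure.map_map h3 measurable_cleanSample]
  change Measure.map Prod.snd _ = _
  rw [Measure.map_snd_prod, measure_univ, one_smul]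

lemma ae_uniformSign : ∀ᵐ s ∂uniformSign, s = 1 ∨ s = -1 := by
  have hm : MeasurableSet {s : ℝ | s = 1 ∨ s = -1} :=
    (measurableSet_singleton 1).union (measurableSet_singleton (-1))
  rw [uniformSign, ae_add_measure_iff]
  exact ⟨Measure.ae_smul_measure ((ae_dirac_iff hm).2 (Or.inl rfl)) _,
    Measure.ae_smul_measure ((ae_dirac_iff hm).2 (Or.inr rfl)) _⟩

lemma ae_flipSign : ∀ᵐ s ∂flipSign η, s = 1 ∨ s = -1 := by
  have hm : MeasurableSet {s : ℝ | s = 1 ∨ s = -1} :=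
    (measurableSet_singleton 1).union (measurableSet_singleton (-1))
  rw [flipSign, ae_add_measure_iff]
  exact ⟨Measure.ae_smul_measure ((ae_dirac_iff hm).2 (Or.inl rfl)) _,
    Measure.ae_smul_measure ((ae_dirac_iff hm).2 (Or.inr rfl)) _⟩

lemma ae_regular (hρ : 0 < ρ) (h₁ : ‖μ₁‖ = ρ) (h₂ : ‖μ₂‖ = ρ) (h₁₂ : inner ℝ μ₁ μ₂ = 0)
    (h0 : 0 ≤ η) (h1 : η ≤ 1) : ∀ᵐ z ∂dataLaw ρ η μ₁ μ₂, Regular μ₁ μ₂ z := by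
  have := isProbabilityMeasure_flipSign h0 h1
  have hnoise : ∀ᵐ z ∂dataLaw ρ η μ₁ μ₂,
      inner ℝ μ₁ (tokens z 1) = 0 ∧ inner ℝ μ₂ (tokens z 1) = 0 :=
    (measurePreserving_noise h0 h1).quasiMeasurePreserving.ae
      (ae_noiseLaw_inner_eq_zero hρ h₁ h₂ h₁₂)
  have hclean : ∀ᵐ c ∂cleanLaw ρ μ₁ μ₂, (c.2 = 1 ∨ c.2 = -1) ∧ c.1 0 = signal μ₁ μ₂ c.2 := by
    rw [cleanLaw, ae_map_iff measurable_cleanSample.aemeasurable]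
    · filter_upwards [Measure.quasiMeasurePreserving_fst.ae ae_uniformSign] with w hw
      exact ⟨hw, rfl⟩
    · refine MeasurableSet.inter ?_ ?_
      · exact measurable_snd ((measurableSet_singleton 1).union (measurableSet_singleton (-1)))
      · exact measurableSet_eq_fun ((measurable_pi_apply 0).comp measurable_fst)
          (measurable_signal.comp measurable_snd)
  have hlabel : ∀ᵐ z ∂dataLaw ρ η μ₁ μ₂, ((trueLabel z = 1 ∨ trueLabel z = -1) ∧
      (label z = 1 ∨ label z = -1)) ∧ tokens z 0 = signal μ₁ μ₂ (trueLabel z) := by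
    rw [dataLaw, ae_map_iff measurable_flip.aemeasurable]
    · filter_upwards [Measure.quasiMeasurePreserving_fst.ae hclean,
        Measure.quasiMeasurePreserving_snd.ae ae_flipSign] with w hw hw'
      refine ⟨⟨hw.1, ?_⟩, hw.2⟩
      change w.2 * w.1.2 = 1 ∨ w.2 * w.1.2 = -1
      rcases hw.1 with e | e <;> rcases hw' with e' | e' <;> rw [e, e'] <;> norm_num
    · refine MeasurableSet.inter (MeasurableSet.inter ?_ ?_) ?_
      · exact measurable_trueLabel
          ((measurableSet_singleton 1).union (measurableSet_singleton (-1)))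
      · exact measurable_label ((measurableSet_singleton 1).union (measurableSet_singleton (-1)))
      · exact measurableSet_eq_fun (measurable_tokens 0)
          (measurable_signal.comp measurable_trueLabel)
  filter_upwards [hnoise, hlabel] with z hz hz'
  exact ⟨hz'.1.1, hz'.1.2, hz'.2, hz.1, hz.2⟩

lemma measurableSet_isClean : MeasurableSet {z : Sample d | IsClean z} :=
  measurableSet_eq_fun measurable_trueLabel measurable_label

lemma measurableSet_isClean_label (s : ℝ) :
    MeasurableSet {z : Sample d | IsClean z ∧ label z = s} :=
  measurableSet_isClean.inter (measurable_label (measurableSet_singleton s))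

lemma flipSign_one (h0 : 0 ≤ η) (h1 : η ≤ 1) : 1 - η ≤ (flipSign η).real {1} := by
  have := isProbabilityMeasure_flipSign h0 h1
  rw [measureReal_def, ENNReal.ofReal_le_iff_le_toReal (measure_ne_top _ _) |>.symm]
  simp [flipSign]

lemma uniformSign_ge {s : ℝ} (hs : s = 1 ∨ s = -1) : 1 / 2 ≤ uniformSign.real {s} := by
  rw [measureReal_def, ENNReal.ofReal_le_iff_le_toReal (measure_ne_top _ _) |>.symm]
  rw [one_div, ENNReal.ofReal_inv_of_pos two_pos]
  rcases hs with rfl | rfl <;> simp [uniformSign]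

/-- The flip factor is independent of the true label, and the event contains the product of true
label s with flip factor 1. -/
lemma dataLaw_isClean_label (h0 : 0 ≤ η) (h1 : η ≤ 1) {s : ℝ} (hs : s = 1 ∨ s = -1) :
    (1 - η) / 2 ≤ (dataLaw ρ η μ₁ μ₂).real {z | IsClean z ∧ label z = s} := by
  have := isProbabilityMeasure_flipSign h0 h1
  rw [dataLaw, map_measureReal_apply measurable_flip (measurableSet_isClean_label s)]
  have hcl : 1 / 2 ≤ (cleanLaw ρ μ₁ μ₂).real {c | c.2 = s} := by
    have hm : MeasurableSet {c : Tokens d × ℝ | c.2 = s} :=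
      measurable_snd (measurableSet_singleton s)
    rw [cleanLaw, map_measureReal_apply measurable_cleanSample hm]
    have : (fun w : ℝ × Vec d => ((![signal μ₁ μ₂ w.1, w.2], w.1) : Tokens d × ℝ)) ⁻¹'
        {c | c.2 = s} = {s} ×ˢ Set.univ := by ext w; simp
    rw [this, measureReal_prod_prod]
    simpa using uniformSign_ge hs
  calc (1 - η) / 2 = 1 / 2 * (1 - η) := by ring
    _ ≤ (cleanLaw ρ μ₁ μ₂).real {c | c.2 = s} * (flipSign η).real {1} :=
        mul_le_mul hcl (flipSign_one h0 h1) (by linarith) (by positivity)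
    _ = ((cleanLaw ρ μ₁ μ₂).prod (flipSign η)).real ({c | c.2 = s} ×ˢ {1}) :=
        (measureReal_prod_prod _ _).symm
    _ ≤ _ := by
        refine measureReal_mono fun w hw => ?_
        obtain ⟨e, e'⟩ := hw
        have e : w.1.2 = s := e
        have e' : w.2 = 1 := e'
        change w.1.2 = w.2 * w.1.2 ∧ w.2 * w.1.2 = s
        rw [e', one_mul]
        exact ⟨rfl, e⟩

lemma dataLaw_isClean (h0 : 0 ≤ η) (h1 : η ≤ 1) :
    1 - η ≤ (dataLaw ρ η μ₁ μ₂).real {z | IsClean z} := by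
  have := isProbabilityMeasure_flipSign h0 h1
  rw [dataLaw, map_measureReal_apply measurable_flip measurableSet_isClean]
  calc 1 - η ≤ (cleanLaw ρ μ₁ μ₂).real Set.univ * (flipSign η).real {1} := by
        simpa using flipSign_one h0 h1
    _ = ((cleanLaw ρ μ₁ μ₂).prod (flipSign η)).real (Set.univ ×ˢ {1}) :=
        (measureReal_prod_prod _ _).symm
    _ ≤ _ := by
        refine measureReal_mono fun w hw => ?_
        have e' : w.2 = 1 := hw.2
        change w.1.2 = w.2 * w.1.2
        rw [e', one_mul]

end DataLaw

/-! ### Independence of noise tokens across samples. -/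

section TrainingLaw

variable {d n : ℕ} {ρ η : ℝ} {μ₁ μ₂ : Vec d}

lemma measurePreserving_noise_eval (h0 : 0 ≤ η) (h1 : η ≤ 1) (i : Fin n) :
    MeasurePreserving (fun S : Fin n → Sample d => tokens (S i) 1) (trainingLaw n ρ η μ₁ μ₂)
      (noiseLaw ρ μ₁ μ₂) :=
  have := isProbabilityMeasure_dataLaw (ρ := ρ) (μ₁ := μ₁) (μ₂ := μ₂) h0 h1
  (measurePreserving_noise h0 h1).comp (measurePreserving_eval _ i)

lemma measurePreserving_noise_pair (h0 : 0 ≤ η) (h1 : η ≤ 1) {i j : Fin n} (hij : i ≠ j) :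
    MeasurePreserving (fun S : Fin n → Sample d => (tokens (S i) 1, tokens (S j) 1))
      (trainingLaw n ρ η μ₁ μ₂) ((noiseLaw ρ μ₁ μ₂).prod (noiseLaw ρ μ₁ μ₂)) := by
  have := isProbabilityMeasure_dataLaw (ρ := ρ) (μ₁ := μ₁) (μ₂ := μ₂) h0 h1
  have hi := measurePreserving_noise_eval (ρ := ρ) (μ₁ := μ₁) (μ₂ := μ₂) h0 h1 i
  have hj := measurePreserving_noise_eval (ρ := ρ) (μ₁ := μ₁) (μ₂ := μ₂) h0 h1 j
  refine ⟨hi.measurable.prodMk hj.measurable, ?_⟩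
  have hind : iIndepFun (fun i (S : Fin n → Sample d) => tokens (S i) 1)
      (trainingLaw n ρ η μ₁ μ₂) :=
    iIndepFun_pi (X := fun _ z => tokens z 1) (fun _ => (measurable_tokens 1).aemeasurable)
  have : IsProbabilityMeasure (trainingLaw n ρ η μ₁ μ₂) := by unfold trainingLaw; infer_instance
  have h := (indepFun_iff_map_prod_eq_prod_map_map hi.measurable.aemeasurable
    hj.measurable.aemeasurable).1 (hind.indepFun hij)
  rw [h, hi.map_eq, hj.map_eq]

/-- Two noise tokens are nearly orthogonal with high probability. -/
lemma trainingLaw_abs_inner_ge (hρ : 0 < ρ) (h₁ : ‖μ₁‖ = ρ) (h₂ : ‖μ₂‖ = ρ)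
    (h₁₂ : inner ℝ μ₁ μ₂ = 0) (h0 : 0 ≤ η) (h1 : η ≤ 1) {i j : Fin n} (hij : i ≠ j) {σ t : ℝ}
    (ht : 0 ≤ t) :
    (trainingLaw n ρ η μ₁ μ₂).real {S | ‖tokens (S i) 1‖ ^ 2 ≤ σ ∧
      t ≤ |inner ℝ (tokens (S i) 1) (tokens (S j) 1)|} ≤ 2 * Real.exp (-t ^ 2 / (2 * σ)) := by
  have hmp := measurePreserving_noise_pair (ρ := ρ) (μ₁ := μ₁) (μ₂ := μ₂) h0 h1 hij
  -- Fix the first token x. If its norm is too large the fiber is empty; otherwise the Gaussian tail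
  -- of ⟨x, ·⟩ applies with a bound independent of x.
  set B : Set (Vec d × Vec d) := {x | ‖x.1‖ ^ 2 ≤ σ ∧ t ≤ |inner ℝ x.1 x.2|} with hB
  have hBm : MeasurableSet B :=
    MeasurableSet.inter (s₁ := {x : Vec d × Vec d | ‖x.1‖ ^ 2 ≤ σ})
      (s₂ := {x : Vec d × Vec d | t ≤ |inner ℝ x.1 x.2|})
      (measurableSet_le (by fun_prop) (by fun_prop)) (measurableSet_le (by fun_prop) (by fun_prop))
  have hpre : {S : Fin n → Sample d | ‖tokens (S i) 1‖ ^ 2 ≤ σ ∧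
      t ≤ |inner ℝ (tokens (S i) 1) (tokens (S j) 1)|} =
      (fun S : Fin n → Sample d => (tokens (S i) 1, tokens (S j) 1)) ⁻¹' B := rfl
  rw [hpre, measureReal_def, hmp.measure_preimage hBm.nullMeasurableSet]
  refine ENNReal.toReal_le_of_le_ofReal (by positivity) ?_
  rw [Measure.prod_apply hBm]
  calc ∫⁻ x, noiseLaw ρ μ₁ μ₂ (Prod.mk x ⁻¹' B) ∂noiseLaw ρ μ₁ μ₂
      ≤ ∫⁻ _, ENNReal.ofReal (2 * Real.exp (-t ^ 2 / (2 * σ))) ∂noiseLaw ρ μ₁ μ₂ := by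
        refine lintegral_mono fun x => ?_
        by_cases hx : ‖x‖ ^ 2 ≤ σ
        · have h := noiseLaw_abs_inner_ge hρ h₁ h₂ h₁₂ x hx ht
          rw [← ofReal_measureReal]
          refine ENNReal.ofReal_le_ofReal ((measureReal_mono fun w hw => ?_).trans h)
          exact hw.2
        · have : Prod.mk x ⁻¹' B = ∅ := by
            ext w; simp [hB, hx]
          rw [this]; simp
    _ = _ := by simp

end TrainingLaw

/-! ### Typical training sets have high probability. -/

section TypicalProbability

/-- The bound is (δ/n)⁸; seven factors δ < 1/2 supply the 1/128. -/
lemma exp_neg_le_of_log_ratio {δ x : ℝ} {n : ℕ} (hn : 0 < n) (hδ : 0 < δ) (hδ' : δ < 1 / 2)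
    (hx : 8 * Real.log (n / δ) ≤ x) : Real.exp (-x) ≤ δ / (128 * n ^ 2) := by
  have hn' : (1 : ℝ) ≤ n := by exact_mod_cast hn
  have h1 : Real.exp (-x) ≤ (δ / n) ^ 8 := by
    calc Real.exp (-x) ≤ Real.exp (8 * Real.log (δ / n)) := by
          rw [Real.exp_le_exp, ← inv_div, Real.log_inv]; linarith
      _ = _ := by
          rw [mul_comm, Real.exp_mul, Real.exp_log (by positivity)]
          norm_cast
  refine h1.trans ?_
  rw [div_pow, div_le_div_iff₀ (by positivity) (by positivity)]
  have h2 : δ ^ 7 ≤ (1 / 2) ^ 7 := pow_le_pow_left₀ hδ.le hδ'.le 7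
  have h3 : (n : ℝ) ^ 2 ≤ n ^ 8 := pow_le_pow_right₀ hn' (by norm_num)
  calc δ ^ 8 * (128 * n ^ 2) = δ * (δ ^ 7 * 128) * n ^ 2 := by ring
    _ ≤ δ * 1 * n ^ 8 := by gcongr; linarith
    _ = _ := by ring

lemma exp_neg_le_of_log_inv {δ x : ℝ} (hδ : 0 < δ) (hδ' : δ < 1 / 2)
    (hx : 4 * Real.log (1 / δ) ≤ x) : Real.exp (-x) ≤ δ / 8 := by
  have h1 : Real.exp (-x) ≤ δ ^ 4 := by
    calc Real.exp (-x) ≤ Real.exp (4 * Real.log δ) := by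
          rw [one_div, Real.log_inv] at hx
          rw [Real.exp_le_exp]; linarith
      _ = _ := by
          rw [mul_comm, Real.exp_mul, Real.exp_log hδ]
          norm_cast
  have h2 : δ ^ 3 ≤ (1 / 2) ^ 3 := pow_le_pow_left₀ hδ.le hδ'.le 3
  calc _ ≤ δ ^ 4 := h1
    _ = δ * δ ^ 3 := by ring
    _ ≤ δ * (1 / 2) ^ 3 := by gcongr
    _ = _ := by ring

variable {C δ ρ η R : ℝ} {d n : ℕ} {μ₁ μ₂ : Vec d}

lemma MaxMarginAssumption.samples_pos (h : MaxMarginAssumption C δ ρ η R d n) (hC : 0 < C) :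
    0 < n := by
  have h1 : 0 < Real.log (1 / δ) :=
    Real.log_pos (by rw [lt_div_iff₀ h.δ_pos]; linarith [h.δ_lt])
  exact_mod_cast (mul_pos hC h1).trans_le h.samples_large

lemma MaxMarginAssumption.log_pos (h : MaxMarginAssumption C δ ρ η R d n) (hC : 0 < C) :
    0 < Real.log (n / δ) := by
  have hn : (1 : ℝ) ≤ n := by exact_mod_cast h.samples_pos hC
  exact Real.log_pos (by rw [lt_div_iff₀ h.δ_pos]; linarith [h.δ_lt])

lemma MaxMarginAssumption.dim_pos (h : MaxMarginAssumption C δ ρ η R d n) (hC : 0 < C) :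
    0 < d := by
  have hn : (0 : ℝ) < n := by exact_mod_cast h.samples_pos hC
  have := h.log_pos hC
  exact_mod_cast (by positivity : 0 < C * (n : ℝ) ^ 2 * Real.log (n / δ)).trans_le h.dim_large

lemma MaxMarginAssumption.signal_sq (h : MaxMarginAssumption C δ ρ η R d n) (hC : 1000 ≤ C) :
    1000 * (d : ℝ) ≤ n * ρ ^ 2 := by
  have hn : (0 : ℝ) < n := by exact_mod_cast h.samples_pos (by linarith)
  have h1 : (C * Real.sqrt (d / n)) ^ 2 ≤ ρ ^ 2 :=
    pow_le_pow_left₀ (by positivity) h.signal_large 2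
  rw [mul_pow, Real.sq_sqrt (by positivity)] at h1
  calc 1000 * (d : ℝ) ≤ C ^ 2 * d := by gcongr; nlinarith
    _ = n * (C ^ 2 * (d / n)) := by field_simp
    _ ≤ _ := by gcongr

/-- Strict bounds on the samples that make a training set typical. -/
lemma typical_of_forall (hn : 0 < n) {S : Fin n → Sample d} {q₁ q₂ : ℝ}
    (hreg : ∀ i, Regular μ₁ μ₂ (S i)) (hhi : ∀ i, ‖tokens (S i) 1‖ ^ 2 < 2 * d)
    (hlo : ∀ i, (d : ℝ) / 4 < ‖tokens (S i) 1‖ ^ 2)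
    (hcross : ∀ i j, i ≠ j →
      |inner ℝ (tokens (S i) 1) (tokens (S j) 1)| < (d : ℝ) / (32 * n))
    (hq₁ : 1 / 8 ≤ q₁) (hq₂ : 1 - 1 / 10000 ≤ q₂)
    (hpos : n * q₁ < (cleanWith S 1).card) (hneg : n * q₁ < (cleanWith S (-1)).card)
    (hclean : n * q₂ < n - ((noisy S).card : ℝ)) : Typical μ₁ μ₂ S := by
  have hn' : (0 : ℝ) < n := by exact_mod_cast hn
  refine ⟨hreg, ⟨fun i => (hlo i).le, fun i => (hhi i).le, fun i j hij => (hcross i j hij).le⟩,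
    ?_, ?_, ?_⟩
  · nlinarith
  · nlinarith
  · nlinarith

open Classical in
lemma card_isClean (S : Fin n → Sample d) :
    ((Finset.univ.filter fun i => IsClean (S i)).card : ℝ) = n - ((noisy S).card : ℝ) := by
  have h := Finset.card_filter_add_card_filter_not (s := (Finset.univ : Finset (Fin n)))
    (fun i => IsClean (S i))
  rw [Finset.card_univ, Fintype.card_fin] at h
  have h' : (noisy S).card = (Finset.univ.filter fun i => ¬ IsClean (S i)).card := by
    congr 1
  rw [eq_sub_iff_add_eq, h']
  exact_mod_cast h

/-- A training set is typical with high probability. -/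
theorem trainingLaw_not_typical_le (hC : 10 ^ 10 ≤ C) (hρ : 0 < ρ) (h₁ : ‖μ₁‖ = ρ) (h₂ : ‖μ₂‖ = ρ)
    (h₁₂ : inner ℝ μ₁ μ₂ = 0) (h : MaxMarginAssumption C δ ρ η R d n) :
    (trainingLaw n ρ η μ₁ μ₂).real {S | ¬ Typical μ₁ μ₂ S} ≤ δ := by
  classical
  have hC0 : 0 < C := by linarith
  have hδ := h.δ_pos
  have hn := h.samples_pos hC0
  have hn' : (1 : ℝ) ≤ n := by exact_mod_cast hn
  have hd : (0 : ℝ) < d := by exact_mod_cast h.dim_pos hC0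
  have hη0 := h.flip_nonneg
  have hη : η ≤ 1 / 20000 :=
    h.flip_small.trans (one_div_le_one_div_of_le (by norm_num) (by linarith))
  have hη1 : η ≤ 1 := by linarith
  have := isProbabilityMeasure_dataLaw (ρ := ρ) (μ₁ := μ₁) (μ₂ := μ₂) hη0 hη1
  have : IsProbabilityMeasure (trainingLaw n ρ η μ₁ μ₂) := by unfold trainingLaw; infer_instance
  have hlog := h.log_pos hC0
  have hdim : 10 ^ 10 * (n : ℝ) ^ 2 * Real.log (n / δ) ≤ d :=
    le_trans (by gcongr) h.dim_large
  -- Sized for a union bound over all pairs: norms and inner products contribute at most 6nε + 2n²ε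
  -- ≤ δ/16, and the three counts at most 3δ/8.
  set ε : ℝ := δ / (128 * n ^ 2) with hε
  have hε0 : 0 < ε := by positivity
  have hεn : ε * n ^ 2 = δ / 128 := by rw [hε]; field_simp
  have hεn' : ε * n ≤ δ / 128 := by
    rw [← hεn]; gcongr; nlinarith
  have e₁ : Real.exp (-((d : ℝ) / 16)) ≤ ε := by
    refine exp_neg_le_of_log_ratio hn hδ h.δ_lt ?_
    have : Real.log (n / δ) ≤ (n : ℝ) ^ 2 * Real.log (n / δ) :=
      le_mul_of_one_le_left hlog.le (one_le_pow₀ hn')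
    linarith
  have e₂ : Real.exp (-((d : ℝ) / (32 * n)) ^ 2 / (2 * (2 * d))) ≤ ε := by
    have : -((d : ℝ) / (32 * n)) ^ 2 / (2 * (2 * d)) = -(d / (4096 * n ^ 2)) := by
      field_simp; norm_num
    rw [this]
    refine exp_neg_le_of_log_ratio hn hδ h.δ_lt ?_
    rw [le_div_iff₀ (by positivity)]
    have : 0 ≤ (n : ℝ) ^ 2 * Real.log (n / δ) := by positivity
    linarith
  -- The allowed noisy fraction 1/10000 is shared equally between the flip rate and the sampling
  -- deviation t.
  obtain ⟨t, ht⟩ : ∃ t : ℝ, t = 1 / 20000 := ⟨_, rfl⟩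
  have hq₁ : 1 / 8 ≤ (1 - η) / 2 - t := by rw [ht]; linarith
  have hq₂ : 1 - 1 / 10000 ≤ 1 - η - t := by rw [ht]; linarith
  have e₃ : Real.exp (-(2 * n * t ^ 2)) ≤ δ / 8 := by
    refine exp_neg_le_of_log_inv hδ h.δ_lt ?_
    have h1 : 0 ≤ Real.log (1 / δ) :=
      Real.log_nonneg (by rw [le_div_iff₀ hδ]; linarith [h.δ_lt])
    have h2 : 10 ^ 10 * Real.log (1 / δ) ≤ n := le_trans (by gcongr) h.samples_large
    rw [ht]
    linarith
  set P := trainingLaw n ρ η μ₁ μ₂ with hP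
  let U : Fin n → Set (Fin n → Sample d) := fun i => {S | 2 * (d : ℝ) ≤ ‖tokens (S i) 1‖ ^ 2}
  let L : Fin n → Set (Fin n → Sample d) := fun i => {S | ‖tokens (S i) 1‖ ^ 2 ≤ (d : ℝ) / 4}
  -- The norm bound in the event supplies σ = 2d in the conditional tail; violations of it are
  -- counted in `U`.
  let B : Fin n → Fin n → Set (Fin n → Sample d) := fun i j => {S | i ≠ j ∧
    (‖tokens (S i) 1‖ ^ 2 ≤ 2 * (d : ℝ) ∧
      (d : ℝ) / (32 * n) ≤ |inner ℝ (tokens (S i) 1) (tokens (S j) 1)|)}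
  let H : ℝ → Set (Fin n → Sample d) := fun s =>
    {S | ((cleanWith S s).card : ℝ) ≤ n * ((1 - η) / 2 - t)}
  let K : Set (Fin n → Sample d) := {S | (n : ℝ) - (noisy S).card ≤ n * (1 - η - t)}
  let Z : Set (Fin n → Sample d) := {S | ¬ ∀ i, Regular μ₁ μ₂ (S i)}
  have hZ : P.real Z = 0 := by
    have : ∀ᵐ S ∂P, ∀ i, Regular μ₁ μ₂ (S i) := ae_all_iff.2 fun i =>
      (measurePreserving_eval (fun _ : Fin n => dataLaw ρ η μ₁ μ₂) i).quasiMeasurePreserving.ae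
        (ae_regular hρ h₁ h₂ h₁₂ hη0 hη1)
    rw [measureReal_def, ae_iff.1 this, ENNReal.toReal_zero]
  have hU : ∀ i, P.real (U i) ≤ ε := fun i => by
    have hmp := measurePreserving_noise_eval (ρ := ρ) (μ₁ := μ₁) (μ₂ := μ₂) hη0 hη1 i
    have hm : MeasurableSet {x : Vec d | 2 * (d : ℝ) ≤ ‖x‖ ^ 2} :=
      measurableSet_le (by fun_prop) (by fun_prop)
    have := (hmp.measureReal_preimage hm.nullMeasurableSet).trans_le
      (noiseLaw_norm_sq_ge hρ h₁ h₂ h₁₂)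
    exact this.trans e₁
  have hL : ∀ i, P.real (L i) ≤ 5 * ε := fun i => by
    have hmp := measurePreserving_noise_eval (ρ := ρ) (μ₁ := μ₁) (μ₂ := μ₂) hη0 hη1 i
    have hm : MeasurableSet {x : Vec d | ‖x‖ ^ 2 ≤ (d : ℝ) / 4} :=
      measurableSet_le (by fun_prop) (by fun_prop)
    have := (hmp.measureReal_preimage hm.nullMeasurableSet).trans_le
      (noiseLaw_norm_sq_le hρ h₁ h₂ h₁₂)
    exact this.trans (by linarith)
  have hB : ∀ i j, P.real (B i j) ≤ 2 * ε := fun i j => by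
    by_cases hij : i = j
    · have : B i j = ∅ := by ext S; simp [B, hij]
      rw [this, measureReal_empty]; positivity
    · refine (measureReal_mono fun S hS => hS.2).trans ((trainingLaw_abs_inner_ge hρ h₁ h₂ h₁₂
        hη0 hη1 hij (σ := 2 * d) (t := d / (32 * n)) (by positivity)).trans ?_)
      linarith
  have hH : ∀ s, s = 1 ∨ s = -1 → P.real (H s) ≤ δ / 8 := fun s hs => by
    have := pi_card_le (dataLaw ρ η μ₁ μ₂) n (measurableSet_isClean_label s)
      (dataLaw_isClean_label hη0 hη1 hs) (t := t) (by norm_num [ht])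
    refine le_trans (measureReal_mono fun S hS => ?_) (this.trans e₃)
    have hS' : ((cleanWith S s).card : ℝ) ≤ n * ((1 - η) / 2 - t) := hS
    have hc : (Finset.univ.filter fun i => S i ∈ {z | IsClean z ∧ label z = s}) =
        cleanWith S s := by
      ext i; simp [cleanWith]
    rw [← hc] at hS'
    rw [Set.mem_ofPred_eq]
    convert! hS'
  have hK : P.real K ≤ δ / 8 := by
    have := pi_card_le (dataLaw ρ η μ₁ μ₂) n measurableSet_isClean
      (dataLaw_isClean hη0 hη1) (t := t) (by norm_num [ht])
    refine le_trans (measureReal_mono fun S hS => ?_) (this.trans e₃)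
    have hS' : (n : ℝ) - (noisy S).card ≤ n * (1 - η - t) := hS
    rw [← card_isClean] at hS'
    convert! hS'
  have hsub : {S | ¬ Typical μ₁ μ₂ S} ⊆
      Z ∪ ((⋃ i, U i) ∪ ((⋃ i, L i) ∪ ((⋃ i, ⋃ j, B i j) ∪ (H 1 ∪ (H (-1) ∪ K))))) := by
    intro S hS
    by_contra hcon
    simp only [Set.mem_union, Set.mem_iUnion, not_or, not_exists] at hcon
    obtain ⟨c₁, c₂, c₃, c₄, c₅, c₆, c₇⟩ := hcon
    have c₁ : ¬ ¬ ∀ i, Regular μ₁ μ₂ (S i) := c₁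
    have hhi : ∀ i, ‖tokens (S i) 1‖ ^ 2 < 2 * (d : ℝ) := fun i => not_le.1 (c₂ i)
    refine hS (typical_of_forall hn (not_not.1 c₁) hhi (fun i => not_le.1 (c₃ i))
      (fun i j hij => ?_) hq₁ hq₂
      (not_le.1 c₅) (not_le.1 c₆) (not_le.1 c₇))
    by_contra! hle
    exact c₄ i j ⟨hij, (hhi i).le, hle⟩
  have sU : P.real (⋃ i, U i) ≤ n * ε :=
    (measureReal_iUnion_fintype_le _).trans ((Finset.sum_le_sum fun i _ => hU i).trans_eq (by simp))
  have sL : P.real (⋃ i, L i) ≤ n * (5 * ε) :=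
    (measureReal_iUnion_fintype_le _).trans ((Finset.sum_le_sum fun i _ => hL i).trans_eq (by simp))
  have sB : P.real (⋃ i, ⋃ j, B i j) ≤ n * (n * (2 * ε)) :=
    (measureReal_iUnion_fintype_le _).trans ((Finset.sum_le_sum fun i _ =>
      (measureReal_iUnion_fintype_le _).trans (Finset.sum_le_sum fun j _ => hB i j)).trans_eq
        (by simp))
  have hu : ∀ s t : Set (Fin n → Sample d), P.real (s ∪ t) ≤ P.real s + P.real t :=
    fun s t => measureReal_union_le s t
  have hH1 := hH 1 (Or.inl rfl)
  have hH2 := hH (-1) (Or.inr rfl)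
  calc P.real {S | ¬ Typical μ₁ μ₂ S} ≤ _ := measureReal_mono hsub
    _ ≤ P.real Z + (P.real (⋃ i, U i) + (P.real (⋃ i, L i) + (P.real (⋃ i, ⋃ j, B i j) +
        (P.real (H 1) + (P.real (H (-1)) + P.real K))))) := by
      refine (hu _ _).trans (add_le_add le_rfl ?_)
      refine (hu _ _).trans (add_le_add le_rfl ?_)
      refine (hu _ _).trans (add_le_add le_rfl ?_)
      refine (hu _ _).trans (add_le_add le_rfl ?_)
      refine (hu _ _).trans (add_le_add le_rfl ?_)
      exact hu _ _
    _ ≤ δ := by rw [hZ]; nlinarith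

end TypicalProbability

end TokenSelection

/-! ### The main theorem. -/

theorem mainTheorem5 :
    ∃ C₀ : ℝ, 0 < C₀ ∧ ∃ c : ℝ, 0 < c ∧ ∀ C : ℝ, C₀ ≤ C →
      ∀ (d n : ℕ) (δ ρ η R : ℝ) (μ₁ μ₂ : TokenSelection.Vec d),
        0 < ρ → ‖μ₁‖ = ρ → ‖μ₂‖ = ρ → inner ℝ μ₁ μ₂ = 0 → η < 1 / 2 →
        TokenSelection.MaxMarginAssumption C δ ρ η R d n →
        ∃ G : Set (Fin n → TokenSelection.Sample d), MeasurableSet G ∧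
          1 - δ ≤ (TokenSelection.trainingLaw n ρ η μ₁ μ₂).real G ∧
          ∀ S ∈ G,
            (∃ vmm, TokenSelection.IsSVMOpt S vmm) ∧
            (∀ p, ∃ v, TokenSelection.IsSVMAt S p v) ∧
            ∀ vmm, TokenSelection.IsSVMOpt S vmm →
              ∀ p v, TokenSelection.IsSVMAt S p v →
                TokenSelection.labelMargin v ≤
                  TokenSelection.labelMargin vmm -
                    c / (‖vmm‖ ^ 3 * n * ρ ^ 2) * TokenSelection.deviation S p := by
  open TokenSelection in
  -- The Hoeffding exponent 2nt² = n/(2·10⁸) makes the largest demand on C₀, since it has to exceed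
  -- 4 log(1/δ). The value c = 1/4 is that of `one_div_le_of_sq_gap`.
  refine ⟨10 ^ 10, by norm_num, 1 / 4, by norm_num, ?_⟩
  intro C hC d n δ ρ η R μ₁ μ₂ hρ h₁ h₂ h₁₂ hη h
  have hC0 : 0 < C := by linarith
  have := isProbabilityMeasure_dataLaw (ρ := ρ) (μ₁ := μ₁) (μ₂ := μ₂) h.flip_nonneg
    (by linarith : η ≤ 1)
  have : IsProbabilityMeasure (trainingLaw n ρ η μ₁ μ₂) := by unfold trainingLaw; infer_instance
  have hbad := trainingLaw_not_typical_le hC hρ h₁ h₂ h₁₂ h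
  set P := trainingLaw n ρ η μ₁ μ₂
  -- A measurable hull of the atypical sets has the same measure, so its complement is a measurable
  -- event of typical sets, with no need for `Typical` itself to be measurable.
  refine ⟨(toMeasurable P {S | ¬ Typical μ₁ μ₂ S})ᶜ, (measurableSet_toMeasurable _ _).compl, ?_,
    fun S hS => ?_⟩
  · rw [probReal_compl_eq_one_sub (measurableSet_toMeasurable _ _), measureReal_def,
      measure_toMeasurable, ← measureReal_def]
    linarith
  · have hT : Typical μ₁ μ₂ S := by
      by_contra hcon
      exact hS (subset_toMeasurable P _ hcon)
    exact ⟨hT.exists_isSVMOpt (h.dim_pos hC0) hρ h₁ h₂ h₁₂, hT.exists_isSVMAt (h.dim_pos hC0),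
      fun vmm hvmm p v hv => hT.labelMargin_le (h.dim_pos hC0) (h.samples_pos hC0) hρ h₁ h₂ h₁₂
        (h.signal_sq (by linarith)) hvmm hv⟩
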